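/- **Proposition (noise reinforced Lévy processes on $\mathbb{R}^+$).** Let $(a,q^2,\Lambda)$ be the triplet of a real Lévy process, i.e. $a,q\in\mathbb{R}$ and $\Lambda$ is a measure on $\mathbb{R}$ with $\Lambda(\{0\})=0$ and $\int (1\wedge x^2)\,\Lambda(dx)<\infty$, with characteristic exponent $$\Psi(\lambda)=ia\lambda-\tfrac{q^2}{2}\lambda^2+\int_{\mathbb{R}}\big(e^{i\lambda x}-1-i\lambda x\mathbf 1_{\{|x|\le 1\}}\big)\Lambda(dx).$$ Let $\beta(\Lambda)=\inf\{r>0:\int_{\{|x|\le 1\}}|x|^r\Lambda(dx)<\infty\}$, and let $\beta=\beta(\Lambda)$ if $q=0$ and $\beta=2$ if $q\neq 0$. Let $p\in(0,1)$ be admissible for the triplet, i.e. $p\beta<1$. Let $Y$ be the Yule–Simon process with parameter $1/p$, $$Y(t)=\mathbf 1_{\{U\le t\}}\,Z_{p(\ln t-\ln U)},\qquad t\in[0,1],$$ where $U$ is uniform on $[0,1]$ and $Z$ is an independent standard Yule process (the pure birth process started from $1$ with birth rate $k$ in state $k$). (i) For all $k$, $\lambda_1,\dots,\lambda_k\in\mathbb{R}$,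 $t>0$ and $s_1,\dots,s_k\in[0,t]$, the random variable $\Psi\big(\sum_{i}\lambda_iY(s_i/t)\big)$ is integrable, and $(1-p)\,t\,\mathbb{E}\big[\Psi\big(\sum_{i}\lambda_iY(s_i/t)\big)\big]$ does not depend on the choice of $t>0$ with $t\ge \max_i s_i$. (ii) There exists a real-valued process $\hat\xi=(\hat\xi_s)_{s\ge 0}$ such that, for all $k$, $\lambda_1,\dots,\lambda_k\in\mathbb{R}$, $t>0$ and $s_1,\dots,s_k\in[0,t]$, $$\mathbb{E}\Big[\exp\Big\{i\sum_{i=1}^k\lambda_i\hat\xi_{s_i}\Big\}\Big]=\exp\Big\{(1-p)\,t\,\mathbb{E}\Big[\Psi\Big(\sum_{i=1}^k\lambda_iY(s_i/t)\Big)\Big]\Big\}.$$ (iii) The process $\hat\xi$ extends the noise reinforced Lévy process on $[0,1]$ with the same characteristics $(a,q^2,\Lambda,p)$, i.e. the process $(X_s)_{s\in[0,1]}$ whose finite-dimensional characteristic functions are $\mathbb{E}[\exp\{i\sum_i\lambda_iX_{s_i}\}]=\exp\{(1-p)\,\mathbb{E}[\Psi(\sum_i\lambda_iY(s_i))]\}$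 for $s_1,\dots,s_k\in[0,1]$: the restriction $(\hat\xi_s)_{s\in[0,1]}$ is such a process, and every such process has the same law on $\mathbb{R}^{[0,1]}$ as this restriction. -/

import Mathlib

open MeasureTheory ProbabilityTheory
open scoped NNReal ENNReal

noncomputable section

namespace NoiseReinforced

/-- `Λ` is a Lévy measure on `ℝ`: no mass at `0`, and `∫ (1 ∧ x²) Λ(dx) < ∞`. -/
structure IsLevyMeasure (Λ : Measure ℝ) : Prop where
  zero_atom : Λ {0} = 0
  lintegral_lt_top : ∫⁻ x, ENNReal.ofReal (min 1 (x ^ 2)) ∂Λ < ∞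

/-- The characteristic exponent of the Lévy triplet `(a, q², Λ)` (Lévy–Khintchine formula). -/
def levyExponent (a q : ℝ) (Λ : Measure ℝ) (z : ℝ) : ℂ :=
  Complex.I * a * z - (q : ℂ) ^ 2 / 2 * (z : ℂ) ^ 2 +
    ∫ x : ℝ, (Complex.exp (Complex.I * z * x) - 1 -
      Complex.I * x * z * (if |x| ≤ 1 then 1 else 0)) ∂Λ

/-- The (upper) Blumenthal–Getoor index `β(Λ)` of a Lévy measure. -/
def bgIndexMeasure (Λ : Measure ℝ) : ℝ :=
  sInf {r : ℝ | 0 < r ∧ ∫⁻ x in {x : ℝ | |x| ≤ 1}, ENNReal.ofReal (|x| ^ r) ∂Λ < ∞}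

/-- The Blumenthal–Getoor index of a Lévy process with triplet `(a, q², Λ)`. -/
def bgIndex (q : ℝ) (Λ : Measure ℝ) : ℝ :=
  if q ^ 2 = 0 then bgIndexMeasure Λ else 2

/-- The memory parameter `p ∈ (0, 1)` is admissible for a triplet `(a, q², Λ)`. -/
structure IsAdmissible (p q : ℝ) (Λ : Measure ℝ) : Prop where
  pos : 0 < p
  lt_one : p < 1
  mul_bgIndex_lt_one : p * bgIndex q Λ < 1

/-- The sample space carrying a time `u` and a sequence `e` of holding times. -/
abbrev YuleSpace : Type := ℝ × (ℕ → ℝ)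

/-- `u` is uniform on `[0, 1]`, `e k` is exponential with rate `k + 1`, all independent. -/
def yuleMeasure : Measure YuleSpace :=
  ((volume : Measure ℝ).restrict (Set.Icc 0 1)).prod
    (Measure.infinitePi fun k : ℕ => expMeasure ((k : ℝ) + 1))

/-- The time of the `n`-th jump (counted from `n = 0`), from state `n + 1` to state `n + 2`, of the
pure birth process started from `1` that stays in state `k + 1` for the time `e k`. -/
def yuleJumpTime (e : ℕ → ℝ) (n : ℕ) : ℝ := ∑ k ∈ Finset.range (n + 1), e k

/-- The standard Yule process (the pure birth process started from `1`, with birth rate `k` in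
state `k`), as a function of its holding times. Almost surely only finitely many jump times are
`≤ r`; the value on the exceptional null set is irrelevant. -/
def yule (e : ℕ → ℝ) (r : ℝ) : ℕ := 1 + {n : ℕ | yuleJumpTime e n ≤ r}.ncard

/-- The Yule–Simon process with parameter `1 / p` on `[0, 1]`:
`Y(t) = 1_{u ≤ t} Z_{p (log t - log u)}`, with `u` uniform on `[0, 1]` and `Z` an independent
standard Yule process. -/
def yuleSimon (p t : ℝ) (ω : YuleSpace) : ℕ :=
  if ω.1 ≤ t then yule ω.2 (p * (Real.log t - Real.log ω.1)) else 0

/-- The random variable `Ψ(∑ i, l i * Y(r i))`, where `Y` is the Yule–Simon process with parameter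
`1 / p` and `Ψ` is the characteristic exponent of `(a, q², Λ)`. -/
def exponentAt (a q : ℝ) (Λ : Measure ℝ) (p : ℝ) {k : ℕ} (l r : Fin k → ℝ) (ω : YuleSpace) : ℂ :=
  levyExponent a q Λ (∑ i, l i * (yuleSimon p (r i) ω : ℝ))

/-- `X` is a noise reinforced Lévy process on `[0, 1]` with characteristics `(a, q², Λ, p)`: a
real process on `[0, 1]` with the finite-dimensional characteristic functions
`exp ((1 - p) E[Ψ(∑ i, l i * Y(s i))])`. -/
structure IsNRLPUnit (a q : ℝ) (Λ : Measure ℝ) (p : ℝ) {Ω : Type*} [MeasurableSpace Ω]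
    (P : Measure Ω) (X : unitInterval → Ω → ℝ) : Prop where
  measurable : ∀ s, Measurable (X s)
  charFun_eq : ∀ (k : ℕ) (l : Fin k → ℝ) (s : Fin k → unitInterval),
    ∫ ω, Complex.exp (Complex.I * ((∑ i, l i * X (s i) ω : ℝ) : ℂ)) ∂P =
      Complex.exp ((1 - p) *
        ∫ ω, exponentAt a q Λ p l (fun i => (s i : ℝ)) ω ∂yuleMeasure)

/-- `X` is a noise reinforced Lévy process on `[0, ∞)` with characteristics `(a, q², Λ, p)`: a
real process on `[0, ∞)` such that, for all times `s i ≤ t`, the characteristic function of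
`(X (s i))_i` is `exp ((1 - p) t E[Ψ(∑ i, l i * Y(s i / t))])`. -/
structure IsNRLP (a q : ℝ) (Λ : Measure ℝ) (p : ℝ) {Ω : Type*} [MeasurableSpace Ω]
    (P : Measure Ω) (X : ℝ≥0 → Ω → ℝ) : Prop where
  measurable : ∀ s, Measurable (X s)
  charFun_eq : ∀ (k : ℕ) (l : Fin k → ℝ) (s : Fin k → ℝ≥0) (t : ℝ≥0), 0 < t → (∀ i, s i ≤ t) →
    ∫ ω, Complex.exp (Complex.I * ((∑ i, l i * X (s i) ω : ℝ) : ℂ)) ∂P =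
      Complex.exp ((1 - p) * (t : ℝ) *
        ∫ ω, exponentAt a q Λ p l (fun i => (s i : ℝ) / t) ω ∂yuleMeasure)

end NoiseReinforced

end

/-! Independence of `t` is a change of variables. If `U` is uniform on `[0, 1]`, then `v = tU` is
uniform on `[0, t]`, and `Y(s/t)` read through `v` is `1_{v ≤ s} Z_{p(log s - log v)}`, which no
longer involves `t`. Hence `t E[Ψ(∑ λᵢ Y(sᵢ/t))]` is an integral over birth times `v ∈ (0, t]`;
since `Ψ 0 = 0`, births after `max sᵢ` contribute nothing, and the integral may be taken over `(0,
∞)`, i.e. against `birthMeasure` (`mul_integral_yuleSimon_div`).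

Integrability is where admissibility enters. It gives `γ ∈ [1, 2]` with `pγ < 1` and `|Ψ(z)| ≤ C(1 +
|z|^γ)`. The Yule process satisfies `E[Z_r^γ] ≤ (γ e^r)^γ` (`lintegral_yule_rpow_le`), so a birth at
time `v` costs at most a constant times `(s/v)^(pγ)`, which is integrable at `0`.

Existence rests on `IsDivExponent.mixture`: averaging an infinitely divisible exponent over random
directions `Y` again gives an infinitely divisible exponent. Indeed, if `ξ_{τ/n}` has exponent
`(τ/n)ψ` and is independent of `Y`, the characteristic function of `ξ_{τ/n} Y`, raised to the power
`n`, converges to `exp(τ E[ψ⟨Y, l⟩])`, and Lévy's continuity theorem applies. The same lemma gives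
compound Poisson laws, and by truncating small jumps the Lévy–Khintchine formula. The resulting
finite-dimensional laws are consistent because characteristic functions determine them, and
Kolmogorov's theorem gives the process. Uniqueness in law on `[0, 1]` is again determination by
characteristic functions. -/

namespace NoiseReinforced

/-! ### Kolmogorov extension for real-valued families -/

section Kolmogorov

open Filter Topology

variable {ι : Type*} {P : ∀ J : Finset ι, Measure (J → ℝ)} [∀ J, IsFiniteMeasure (P J)]

/-- A sequence of compact cylinders with the finite intersection property has a common point. -/
lemma nonempty_iInter_cylinder_of_isCompact {I : ℕ → Finset ι} {K : ∀ n, Set (I n → ℝ)}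
    (hK : ∀ n, IsCompact (K n))
    (h : ∀ n, (⋂ k ≤ n, cylinder (α := fun _ : ι => ℝ) (I k) (K k)).Nonempty) :
    (⋂ n, cylinder (α := fun _ : ι => ℝ) (I n) (K n)).Nonempty := by
  classical
  -- A compact box for Tychonoff: each coordinate is confined by the first `K n` that constrains it.
  -- The value `0` is added so that coordinates not met up to stage `n` can be reset to `0`.
  let C : ι → Set ℝ := fun i =>
    if hi : ∃ n, i ∈ I n then
      insert 0 ((fun x : I (Nat.find hi) → ℝ => x ⟨i, Nat.find_spec hi⟩) '' K (Nat.find hi))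
    else {0}
  have hC : ∀ i, IsCompact (C i) := by
    intro i
    by_cases hi : ∃ n, i ∈ I n
    · simp only [C, dif_pos hi]
      exact ((hK _).image (continuous_apply _)).insert 0
    · simp only [C, dif_neg hi]
      exact isCompact_singleton
  have h0C : ∀ i, (0 : ℝ) ∈ C i := by
    intro i
    by_cases hi : ∃ n, i ∈ I n
    · simp [C, dif_pos hi]
    · simp [C, dif_neg hi]
  let F : ℕ → Set (ι → ℝ) := fun n =>
    Set.univ.pi C ∩ ⋂ k ≤ n, cylinder (α := fun _ : ι => ℝ) (I k) (K k)
  have hclosed : ∀ n, IsClosed (⋂ k ≤ n, cylinder (α := fun _ : ι => ℝ) (I k) (K k)) := fun n =>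
    isClosed_biInter fun k _ => (hK k).isClosed.preimage (by fun_prop)
  have hcpt : ∀ n, IsCompact (F n) := fun n =>
    (isCompact_univ_pi hC).inter_right (hclosed n)
  have hne : ∀ n, (F n).Nonempty := by
    intro n
    obtain ⟨x, hx⟩ := h n
    simp only [Set.mem_iInter, mem_cylinder] at hx
    refine ⟨fun i => if ∃ k ≤ n, i ∈ I k then x i else 0, ?_, ?_⟩
    · intro i _
      simp only
      split_ifs with hi
      · obtain ⟨k, hkn, hik⟩ := hi
        have hi : ∃ n, i ∈ I n := ⟨k, hik⟩
        simp only [C, dif_pos hi]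
        refine Or.inr ⟨_, hx (Nat.find hi) ((Nat.find_min' hi hik).trans hkn), rfl⟩
      · exact h0C i
    · simp only [Set.mem_iInter, mem_cylinder]
      intro k hk
      convert hx k hk using 1
      ext ⟨i, hi⟩
      simp only [Finset.restrict]
      rw [if_pos ⟨k, hk, hi⟩]
  have hanti : ∀ n, F (n + 1) ⊆ F n := fun n =>
    fun x hx => by
      simp only [F, Set.mem_inter_iff, Set.mem_iInter] at hx ⊢
      exact ⟨hx.1, fun k hk => hx.2 k (Nat.le_succ_of_le hk)⟩
  obtain ⟨x, hx⟩ := IsCompact.nonempty_iInter_of_sequence_nonempty_isCompact_isClosed F hanti hne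
    (hcpt 0) (fun n => (hcpt n).isClosed)
  refine ⟨x, Set.mem_iInter.2 fun n => ?_⟩
  have := (Set.mem_iInter.1 hx n).2
  simp only [Set.mem_iInter] at this
  exact this n le_rfl

/-- Inner regularity replaces each cylinder by a compact one at small cost; if the contents did not
tend to `0`, the compact cylinders would have the finite intersection property, hence a common
point. This continuity at `∅` is what makes the content σ-additive. -/
lemma projectiveFamilyContent_tendsto_zero (hP : IsProjectiveMeasureFamily (α := fun _ : ι => ℝ) P)
    {A : ℕ → Set (ι → ℝ)} (hA : ∀ n, A n ∈ measurableCylinders fun _ : ι => ℝ) (hanti : Antitone A)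
    (hinter : ⋂ n, A n = ∅) :
    Tendsto (fun n => projectiveFamilyContent hP (A n)) atTop (𝓝 0) := by
  have hmono : Antitone fun n => projectiveFamilyContent hP (A n) := fun m n hmn =>
    projectiveFamilyContent_mono hP (hA n) (hA m) (hanti hmn)
  have hlim := tendsto_atTop_iInf hmono
  set ε := ⨅ n, projectiveFamilyContent hP (A n) with hε
  by_cases hε0 : ε = 0
  · rwa [hε0] at hlim
  exfalso
  have hle : ∀ n, ε ≤ projectiveFamilyContent hP (A n) := fun n => iInf_le _ n
  obtain ⟨δ, hδ, hsum⟩ := ENNReal.exists_pos_sum_of_countable' hε0 ℕ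
  choose I S hS hAS using fun n => (mem_measurableCylinders _).1 (hA n)
  choose K hKS hK hKδ using fun n =>
    (hS n).exists_isCompact_sdiff_lt (μ := P (I n)) (measure_ne_top _ _) (hδ n).ne'
  have hdiff : ∀ k, A k \ cylinder (I k) (K k) = cylinder (I k) (S k \ K k) := fun k => by
    rw [hAS k]; rfl
  have hdiff_mem : ∀ k, A k \ cylinder (I k) (K k) ∈ measurableCylinders fun _ : ι => ℝ :=
    fun k => by
      rw [hdiff k]
      exact cylinder_mem_measurableCylinders _ _ ((hS k).diff (hK k).measurableSet)
  obtain ⟨x, hx⟩ := nonempty_iInter_cylinder_of_isCompact hK (fun n => by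
    by_contra hempty
    rw [Set.not_nonempty_iff_eq_empty] at hempty
    -- If the first `n + 1` compact cylinders had no common point, the discarded pieces would cover
    -- `A n`, although their total content is less than `ε`.
    have hsub : A n ⊆ ⋃ k ≤ n, (A k \ cylinder (I k) (K k)) := by
      intro x hx
      have hx' : x ∉ ⋂ k ≤ n, cylinder (α := fun _ : ι => ℝ) (I k) (K k) := by
        rw [hempty]; exact Set.notMem_empty x
      simp only [Set.mem_iInter, not_forall] at hx'
      obtain ⟨k, hk, hxk⟩ := hx'
      exact Set.mem_biUnion (x := k) hk ⟨hanti hk hx, hxk⟩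
    have hU : (⋃ k ≤ n, (A k \ cylinder (I k) (K k))) ∈ measurableCylinders fun _ : ι => ℝ := by
      have := isSetRing_measurableCylinders.biUnion_mem (Finset.range (n + 1))
        (fun k _ => hdiff_mem k)
      simpa only [Finset.mem_range_succ_iff] using this
    have : ε < ε := calc
      ε ≤ projectiveFamilyContent hP (A n) := hle n
      _ ≤ _ := projectiveFamilyContent_mono hP (hA n) hU hsub
      _ ≤ _ := projectiveFamilyContent_iUnion_le hP hdiff_mem n
      _ ≤ ∑ k ∈ Finset.range (n + 1), δ k := Finset.sum_le_sum fun k _ => by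
        rw [hdiff k, projectiveFamilyContent_cylinder hP ((hS k).diff (hK k).measurableSet)]
        exact (hKδ k).le
      _ ≤ ∑' k, δ k := ENNReal.sum_le_tsum _
      _ < ε := hsum
    exact lt_irrefl _ this)
  have : x ∈ ⋂ n, A n := Set.mem_iInter.2 fun n => by
    rw [hAS n]
    exact hKS n (Set.mem_iInter.1 hx n)
  rw [hinter] at this
  exact this

/-- **Kolmogorov's extension theorem** for real-valued processes. -/
theorem exists_isProjectiveLimit (hP : IsProjectiveMeasureFamily (α := fun _ : ι => ℝ) P) :
    ∃ μ : Measure (ι → ℝ), IsProjectiveLimit μ P := by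
  have hsub : (projectiveFamilyContent hP).IsSigmaSubadditive :=
    isSigmaSubadditive_of_addContent_iUnion_eq_tsum isSetRing_measurableCylinders
      (fun f hf hfU hf' => addContent_iUnion_eq_sum_of_tendsto_zero isSetRing_measurableCylinders
        _ (fun s _ => projectiveFamilyContent_ne_top hP)
        (fun _ hs ha hi => projectiveFamilyContent_tendsto_zero hP hs ha hi) hf hfU hf')
  refine ⟨(projectiveFamilyContent hP).measure isSetSemiring_measurableCylinders
    generateFrom_measurableCylinders.ge hsub, fun I => ?_⟩
  ext s hs
  rw [Measure.map_apply (Finset.measurable_restrict I) hs, AddContent.measure_eq, ← cylinder,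
    projectiveFamilyContent_cylinder hP hs]
  · exact generateFrom_measurableCylinders.symm
  · exact cylinder_mem_measurableCylinders _ _ hs

end Kolmogorov

/-! ### Characteristic functions and infinitely divisible exponents -/

section CharFun

open Filter Topology InnerProductSpace

variable {E : Type*} [NormedAddCommGroup E] [InnerProductSpace ℝ E] [MeasurableSpace E]

/-- `f` is the characteristic function of a probability measure. -/
def IsCharFun (f : E → ℂ) : Prop :=
  ∃ μ : Measure E, IsProbabilityMeasure μ ∧ ∀ z, charFun μ z = f z

/-- `ψ` is the characteristic exponent of an infinitely divisible law. -/
def IsDivExponent (ψ : E → ℂ) : Prop :=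
  ∀ τ : ℝ, 0 ≤ τ → IsCharFun fun z => Complex.exp (τ * ψ z)

lemma IsCharFun.norm_le_one {f : E → ℂ} (hf : IsCharFun f) (z : E) : ‖f z‖ ≤ 1 := by
  obtain ⟨μ, hμ, h⟩ := hf
  rw [← h]
  exact norm_charFun_le_one z

lemma IsDivExponent.re_nonpos {ψ : E → ℂ} (hψ : IsDivExponent ψ) (z : E) : (ψ z).re ≤ 0 := by
  simpa [Complex.norm_exp] using (hψ 1 zero_le_one).norm_le_one z

lemma IsDivExponent.const_mul {ψ : E → ℂ} (hψ : IsDivExponent ψ) {c : ℝ} (hc : 0 ≤ c) :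
    IsDivExponent fun z => c * ψ z := by
  intro τ hτ
  obtain ⟨μ, hμ, h⟩ := hψ (τ * c) (mul_nonneg hτ hc)
  exact ⟨μ, hμ, fun z => by rw [h]; push_cast; ring_nf⟩

section Borel

variable [BorelSpace E]

section SecondCountable

variable [SecondCountableTopology E]

lemma IsCharFun.mul {f g : E → ℂ} (hf : IsCharFun f) (hg : IsCharFun g) :
    IsCharFun fun z => f z * g z := by
  obtain ⟨μ, hμ, h⟩ := hf
  obtain ⟨ν, hν, h'⟩ := hg
  exact ⟨μ.conv ν, inferInstance, fun z => by rw [charFun_conv, h, h']⟩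

lemma IsCharFun.pow {f : E → ℂ} (hf : IsCharFun f) (n : ℕ) : IsCharFun fun z => f z ^ n := by
  induction n with
  | zero => exact ⟨Measure.dirac 0, inferInstance, fun z => by simp [charFun_dirac]⟩
  | succ n ih => simpa only [pow_succ] using ih.mul hf

lemma IsDivExponent.add {ψ φ : E → ℂ} (hψ : IsDivExponent ψ) (hφ : IsDivExponent φ) :
    IsDivExponent fun z => ψ z + φ z := fun τ hτ => by
  simpa only [mul_add, Complex.exp_add] using (hψ τ hτ).mul (hφ τ hτ)

end SecondCountable

variable [FiniteDimensional ℝ E]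

/-- Part of Lévy's continuity theorem: a pointwise limit of characteristic functions that is
continuous at `0` is a characteristic function. -/
lemma IsCharFun.of_tendsto {f : E → ℂ} {g : ℕ → E → ℂ} (hg : ∀ n, IsCharFun (g n))
    (hlim : ∀ z, Tendsto (fun n => g n z) atTop (𝓝 (f z))) (hf : ContinuousAt f 0) :
    IsCharFun f := by
  choose μ hμ h using hg
  have hlim' : ∀ z, Tendsto (fun n => charFun (μ n) z) atTop (𝓝 (f z)) := by simpa only [h]
  have htight := isTightMeasureSet_of_tendsto_charFun hf hlim'
  let ν : ℕ → ProbabilityMeasure E := fun n => ⟨μ n, hμ n⟩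
  have hcpt : IsCompact (closure (Set.range ν)) := by
    apply isCompact_closure_of_isTightMeasureSet
    convert htight using 1
    ext m
    exact ⟨fun ⟨_, ⟨n, hn⟩, h⟩ => ⟨n, by rw [← h, ← hn]; rfl⟩,
      fun ⟨n, hn⟩ => ⟨ν n, ⟨n, rfl⟩, hn⟩⟩
  -- An ultrafilter finer than `atTop` replaces the extraction of a subsequence: by tightness the
  -- laws converge along it, and the limit has characteristic function `f`.
  let U : Ultrafilter ℕ := Ultrafilter.of atTop
  obtain ⟨ν', -, hν' : Tendsto ν U (𝓝 ν')⟩ := hcpt.ultrafilter_le_nhds (U.map ν) (by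
    rw [le_principal_iff]
    exact Filter.mem_of_superset (Filter.range_mem_map) subset_closure)
  refine ⟨ν', inferInstance, fun z => ?_⟩
  rw [ProbabilityMeasure.tendsto_iff_forall_integral_rclike_tendsto ℂ] at hν'
  have h1 := hν' (BoundedContinuousFunction.innerProbChar z)
  simp only [← charFun_eq_integral_innerProbChar] at h1
  exact tendsto_nhds_unique h1 ((hlim' z).mono_left (Ultrafilter.of_le _))

lemma IsDivExponent.of_tendsto {ψ : E → ℂ} {φ : ℕ → E → ℂ} (hφ : ∀ n, IsDivExponent (φ n))
    (hlim : ∀ z, Tendsto (fun n => φ n z) atTop (𝓝 (ψ z))) (hψ : ContinuousAt ψ 0) :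
    IsDivExponent ψ := fun τ hτ =>
  IsCharFun.of_tendsto (fun n => hφ n τ hτ)
    (fun z => (Complex.continuous_exp.tendsto _).comp ((hlim z).const_mul _))
    (Complex.continuous_exp.continuousAt.comp (continuousAt_const.mul hψ))

end Borel

/-- Mean value inequality on the half-plane `re ≤ 0`, where `exp` and hence its derivative is
bounded by `1`. It gives a domination uniform in `n` for `n (exp (w / n) - 1)`. -/
lemma norm_exp_sub_one_le_of_re_nonpos {w : ℂ} (hw : w.re ≤ 0) : ‖Complex.exp w - 1‖ ≤ ‖w‖ := by
  have h := (convex_halfSpace_re_le 0).norm_image_sub_le_of_norm_hasDerivWithin_le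
    (f := Complex.exp) (f' := Complex.exp) (C := 1) (x := 0) (y := w)
    (fun x _ => (Complex.hasDerivAt_exp x).hasDerivWithinAt)
    (fun x hx => by simpa [Complex.norm_exp] using hx) (by simp) (by simpa using hw)
  simpa using h

lemma tendsto_natCast_mul_exp_div_sub_one (w : ℂ) :
    Tendsto (fun n : ℕ => (n : ℂ) * (Complex.exp (w / n) - 1)) atTop (𝓝 w) := by
  have h : HasDerivAt (fun t : ℝ => Complex.exp (t * w)) w 0 := by
    have := ((Complex.ofRealCLM.hasDerivAt (x := 0)).mul_const w).cexp
    simpa using this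
  have h2 := h.tendsto_slope_zero_right.comp
    (tendsto_inv_atTop_nhdsGT_zero.comp (tendsto_natCast_atTop_atTop (R := ℝ)))
  refine h2.congr fun n => ?_
  simp [div_eq_inv_mul]

/-- A mixture of the exponents `l ↦ ψ ⟪Y ω, l⟫` is an exponent. -/
lemma IsDivExponent.mixture [BorelSpace E] [FiniteDimensional ℝ E]
    {ψ : ℝ → ℂ} (hψ : IsDivExponent ψ)
    {Ω : Type*} [MeasurableSpace Ω] {m : Measure Ω} [IsProbabilityMeasure m] {Y : Ω → E}
    (hY : Measurable Y) (hint : ∀ l, Integrable (fun ω => ψ ⟪Y ω, l⟫_ℝ) m)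
    (hcont : ContinuousAt (fun l => ∫ ω, ψ ⟪Y ω, l⟫_ℝ ∂m) 0) :
    IsDivExponent fun l => ∫ ω, ψ ⟪Y ω, l⟫_ℝ ∂m := by
  intro τ hτ
  have hmix : ∀ n : ℕ, IsCharFun fun l : E =>
      ∫ ω, Complex.exp ((τ * ψ ⟪Y ω, l⟫_ℝ) / n) ∂m := by
    intro n
    obtain ⟨ρ, hρ, h⟩ := hψ (τ / n) (by positivity)
    -- The law sought is that of `X • Y` with `X ∼ ρ` independent of `Y`; conditioning on `Y` gives
    -- its characteristic function.
    have hZ : Measurable fun x : Ω × ℝ => x.2 • Y x.1 := by fun_prop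
    refine ⟨(m.prod ρ).map fun x => x.2 • Y x.1, Measure.isProbabilityMeasure_map hZ.aemeasurable,
      fun l => ?_⟩
    rw [charFun_apply, integral_map hZ.aemeasurable (by fun_prop), integral_prod]
    · congr 1 with ω
      have := h ⟪Y ω, l⟫_ℝ
      simp only [charFun_apply_real] at this
      rw [mul_div_right_comm, ← Complex.ofReal_natCast, ← Complex.ofReal_div, ← this]
      congr 1 with x
      simp only [inner_smul_left]
      congr 2
      simp [mul_comm]
    · refine (integrable_const (1 : ℝ)).mono' (by fun_prop) (ae_of_all _ fun x => ?_)
      rw [Complex.norm_exp_ofReal_mul_I]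
  refine IsCharFun.of_tendsto (fun n => (hmix n).pow n) (fun l => ?_)
    (Complex.continuous_exp.continuousAt.comp (continuousAt_const.mul hcont))
  have hre : ∀ (n : ℕ) ω, ((τ * ψ ⟪Y ω, l⟫_ℝ) / n).re ≤ 0 := fun n ω => by
    rw [← Complex.ofReal_natCast, Complex.div_ofReal_re, Complex.re_ofReal_mul]
    exact div_nonpos_of_nonpos_of_nonneg
      (mul_nonpos_of_nonneg_of_nonpos hτ (hψ.re_nonpos _)) (Nat.cast_nonneg n)
  have hmeas : ∀ n : ℕ, AEStronglyMeasurable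
      (fun ω => Complex.exp ((τ * ψ ⟪Y ω, l⟫_ℝ) / n)) m := fun n =>
    Complex.continuous_exp.comp_aestronglyMeasurable
      (((hint l).const_mul _).div_const _).aestronglyMeasurable
  -- This is the hypothesis of `(1 + aₙ / n) ^ n → exp a`, with `aₙ = n (E[exp (w / n)] - 1)` and `a
  -- = E[w]`.
  have key : Tendsto (fun n : ℕ => (n : ℂ) *
      ((∫ ω, Complex.exp ((τ * ψ ⟪Y ω, l⟫_ℝ) / n) ∂m) - 1)) atTop
      (𝓝 (τ * ∫ ω, ψ ⟪Y ω, l⟫_ℝ ∂m)) := by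
    have heq : ∀ n : ℕ, (n : ℂ) * ((∫ ω, Complex.exp ((τ * ψ ⟪Y ω, l⟫_ℝ) / n) ∂m) - 1) =
        ∫ ω, (n : ℂ) * (Complex.exp ((τ * ψ ⟪Y ω, l⟫_ℝ) / n) - 1) ∂m := fun n => by
      rw [integral_const_mul, integral_sub _ (integrable_const _)]
      · simp
      · refine (integrable_const (1 : ℝ)).mono' (hmeas n) (ae_of_all _ fun ω => ?_)
        rw [Complex.norm_exp]
        simpa using hre n ω
    simp only [heq]
    rw [← integral_const_mul]
    refine tendsto_integral_of_dominated_convergence (fun ω => ‖τ * ψ ⟪Y ω, l⟫_ℝ‖)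
      (fun n => ((hmeas n).sub aestronglyMeasurable_const).const_mul _)
      ((hint l).const_mul _).norm (fun n => ae_of_all _ fun ω => ?_)
      (ae_of_all _ fun ω => tendsto_natCast_mul_exp_div_sub_one _)
    rcases Nat.eq_zero_or_pos n with rfl | hn
    · simp [mul_nonneg]
    have hn' : (0 : ℝ) < n := Nat.cast_pos.2 hn
    calc _ ≤ (n : ℝ) * ‖(τ * ψ ⟪Y ω, l⟫_ℝ) / n‖ := by
          rw [norm_mul, Complex.norm_natCast]
          gcongr
          exact norm_exp_sub_one_le_of_re_nonpos (hre n ω)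
      _ = _ := by
          rw [norm_div, Complex.norm_natCast, mul_div_cancel₀ _ hn'.ne']
  have := Complex.tendsto_one_add_pow_exp_of_tendsto key
  simpa using this

lemma isDivExponent_dirac (a : ℝ) : IsDivExponent fun z : ℝ => Complex.I * a * z := by
  intro τ _
  refine ⟨Measure.dirac (τ * a), inferInstance, fun z => ?_⟩
  rw [charFun_dirac]
  congr 1
  simp
  ring

lemma isDivExponent_gaussian (q : ℝ) :
    IsDivExponent fun z : ℝ => -((q : ℂ) ^ 2 / 2 * (z : ℂ) ^ 2) := by
  intro τ hτ
  refine ⟨gaussianReal 0 (Real.toNNReal (τ * q ^ 2)), inferInstance, fun z => ?_⟩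
  rw [charFun_gaussianReal]
  congr 1
  have : ((Real.toNNReal (τ * q ^ 2) : ℝ≥0) : ℝ) = τ * q ^ 2 :=
    Real.coe_toNNReal _ (by positivity)
  rw [this]
  push_cast
  ring

lemma isDivExponent_poisson :
    IsDivExponent fun z : ℝ => Complex.exp (z * Complex.I) - 1 := by
  intro τ hτ
  refine ⟨(poissonMeasure τ.toNNReal).map (Nat.cast : ℕ → ℝ),
    Measure.isProbabilityMeasure_map (by fun_prop), fun z => ?_⟩
  rw [charFun_map_cast_poissonMeasure, Real.coe_toNNReal _ hτ]

/-- The exponent of a compound Poisson law. -/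
lemma isDivExponent_compoundPoisson (ν : Measure ℝ) [IsFiniteMeasure ν] :
    IsDivExponent fun z : ℝ => ∫ x, (Complex.exp (Complex.I * z * x) - 1) ∂ν := by
  by_cases hν : ν = 0
  · subst hν
    simpa using isDivExponent_dirac 0
  have : NeZero ν := ⟨hν⟩
  -- The normalised jump law plays the role of `Y` in a mixture of Poisson exponents; the total mass
  -- of `ν` returns as a scalar factor.
  let m : Measure ℝ := (ν Set.univ)⁻¹ • ν
  have hm : IsProbabilityMeasure m := inferInstance
  have hexp : ∀ z x : ℝ, Complex.exp ((⟪x, z⟫_ℝ : ℝ) * Complex.I) - 1 =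
      Complex.exp (Complex.I * z * x) - 1 := fun z x => by
    congr 2
    simp
    ring
  have hbound : ∀ z x : ℝ, ‖Complex.exp (Complex.I * z * x) - 1‖ ≤ 2 := fun z x => by
    refine (norm_sub_le _ _).trans ?_
    rw [mul_assoc, ← Complex.ofReal_mul, Complex.norm_exp_I_mul_ofReal]
    norm_num
  have hmix := (isDivExponent_poisson.mixture (m := m) (Y := id) measurable_id
    (fun z => by
      simp only [id, hexp]
      exact (integrable_const (2 : ℝ)).mono' (by fun_prop) (ae_of_all _ (hbound z)))
    (by
      simp only [id, hexp]
      exact (continuous_of_dominated (bound := fun _ => 2) (fun z => by fun_prop)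
        (fun z => ae_of_all _ (hbound z)) (integrable_const _)
        (ae_of_all _ fun x => by fun_prop)).continuousAt)).const_mul
    (c := ν.real Set.univ) measureReal_nonneg
  convert hmix using 2 with z
  simp only [id, hexp, m, integral_smul_measure]
  have h0 : ν.real Set.univ ≠ 0 := by simpa [Measure.real, ENNReal.toReal_eq_zero_iff] using hν
  have h1 : (ν.real Set.univ : ℂ) ≠ 0 := by exact_mod_cast h0
  rw [ENNReal.toReal_inv, ← Measure.real, Complex.real_smul, ← mul_assoc]
  push_cast
  rw [mul_inv_cancel₀ h1, one_mul]

end CharFun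

/-! ### Lévy–Khintchine formula and growth of the exponent -/

section LevyExponent

open Filter Topology

/-- The function `|x| ^ γ` cut off at `|x| = 1`. -/
noncomputable def cutoffPow (γ x : ℝ) : ℝ := if |x| ≤ 1 then |x| ^ γ else 1

lemma cutoffPow_nonneg (γ x : ℝ) : 0 ≤ cutoffPow γ x := by
  unfold cutoffPow
  split_ifs <;> positivity

@[fun_prop]
lemma measurable_cutoffPow (γ : ℝ) : Measurable (cutoffPow γ) :=
  Measurable.ite (measurableSet_le (by fun_prop) (by fun_prop)) (by fun_prop) (by fun_prop)

/-- For `|u| ≤ 1` the second-order Taylor bound `u²` is at most `|u| ^ γ` since `γ ≤ 2`; for `|u| ≥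
1` the trivial bound `2|u|` suffices since `γ ≥ 1`. -/
lemma norm_exp_I_mul_sub_one_sub_le {γ : ℝ} (h1 : 1 ≤ γ) (h2 : γ ≤ 2) (u : ℝ) :
    ‖Complex.exp (Complex.I * u) - 1 - Complex.I * u‖ ≤ 2 * |u| ^ γ := by
  have hn : ‖Complex.I * (u : ℂ)‖ = |u| := by simp
  rcases le_total |u| 1 with h | h
  · have := Complex.norm_exp_sub_one_sub_id_le (x := Complex.I * u) (by rwa [hn])
    rw [hn] at this
    have h3 : |u| ^ (2 : ℝ) ≤ |u| ^ γ :=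
      Real.rpow_le_rpow_of_exponent_ge' (abs_nonneg _) h (by linarith) h2
    rw [Real.rpow_two] at h3
    have h4 : 0 ≤ |u| ^ γ := by positivity
    linarith
  · have h3 : |u| ^ (1 : ℝ) ≤ |u| ^ γ := Real.rpow_le_rpow_of_exponent_le h h1
    rw [Real.rpow_one] at h3
    have h4 := norm_sub_le (Complex.exp (Complex.I * u) - 1) (Complex.I * u)
    have h5 := Real.norm_exp_I_mul_ofReal_sub_one_le (x := u)
    rw [hn] at h4
    rw [Real.norm_eq_abs] at h5
    linarith

/-- The integrand of the Lévy–Khintchine formula. -/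
noncomputable def levyIntegrand (z x : ℝ) : ℂ :=
  Complex.exp (Complex.I * z * x) - 1 - Complex.I * x * z * (if |x| ≤ 1 then 1 else 0)

lemma levyExponent_eq (a q : ℝ) (Λ : Measure ℝ) (z : ℝ) :
    levyExponent a q Λ z = Complex.I * a * z - (q : ℂ) ^ 2 / 2 * (z : ℂ) ^ 2 +
      ∫ x, levyIntegrand z x ∂Λ := rfl

lemma levyExponent_zero (a q : ℝ) (Λ : Measure ℝ) : levyExponent a q Λ 0 = 0 := by
  simp [levyExponent]

@[fun_prop]
lemma measurable_levyIntegrand (z : ℝ) : Measurable (levyIntegrand z) := by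
  unfold levyIntegrand
  refine Measurable.sub (by fun_prop) (Measurable.mul (by fun_prop) ?_)
  exact Measurable.ite (measurableSet_le (by fun_prop) (by fun_prop)) (by fun_prop) (by fun_prop)

lemma continuous_levyIntegrand_left (x : ℝ) : Continuous fun z => levyIntegrand z x := by
  unfold levyIntegrand
  fun_prop

lemma norm_exp_I_mul_mul_sub_one_le (z x : ℝ) :
    ‖Complex.exp (Complex.I * z * x) - 1‖ ≤ 2 := by
  refine (norm_sub_le _ _).trans ?_
  rw [mul_assoc, ← Complex.ofReal_mul, Complex.norm_exp_I_mul_ofReal]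
  norm_num

lemma norm_levyIntegrand_le {γ : ℝ} (h1 : 1 ≤ γ) (h2 : γ ≤ 2) (z x : ℝ) :
    ‖levyIntegrand z x‖ ≤ 2 * (1 + |z| ^ γ) * cutoffPow γ x := by
  have hz : 0 ≤ |z| ^ γ := by positivity
  unfold levyIntegrand cutoffPow
  split_ifs with hx
  · have := norm_exp_I_mul_sub_one_sub_le h1 h2 (z * x)
    rw [abs_mul, Real.mul_rpow (abs_nonneg _) (abs_nonneg _)] at this
    have hx0 : 0 ≤ |x| ^ γ := by positivity
    calc _ = ‖Complex.exp (Complex.I * (z * x : ℝ)) - 1 - Complex.I * (z * x : ℝ)‖ := by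
          push_cast; ring_nf
      _ ≤ _ := this
      _ ≤ _ := by nlinarith
  · simp only [mul_zero, sub_zero, mul_one]
    have := norm_exp_I_mul_mul_sub_one_le z x
    linarith

variable {Λ : Measure ℝ}

lemma IsLevyMeasure.integrable_min (hΛ : IsLevyMeasure Λ) :
    Integrable (fun x : ℝ => min 1 (x ^ 2)) Λ := by
  refine ⟨by fun_prop, ?_⟩
  rw [hasFiniteIntegral_iff_ofReal (ae_of_all _ fun x => by positivity)]
  exact hΛ.lintegral_lt_top

lemma IsLevyMeasure.setLIntegral_rpow_two_lt_top (hΛ : IsLevyMeasure Λ) :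
    ∫⁻ x in {x : ℝ | |x| ≤ 1}, ENNReal.ofReal (|x| ^ (2 : ℝ)) ∂Λ < ∞ := by
  refine lt_of_le_of_lt ?_ hΛ.lintegral_lt_top
  refine le_trans (setLIntegral_mono' (measurableSet_le (by fun_prop) (by fun_prop))
    fun x hx => ?_) (setLIntegral_le_lintegral {x : ℝ | |x| ≤ 1} _)
  have hx' : |x| ≤ 1 := hx
  refine ENNReal.ofReal_le_ofReal ?_
  rw [Real.rpow_two, sq_abs, le_min_iff]
  exact ⟨by rw [← sq_abs]; exact pow_le_one₀ (abs_nonneg _) hx', le_rfl⟩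

lemma IsLevyMeasure.integrable_cutoffPow (hΛ : IsLevyMeasure Λ) {r γ : ℝ} (hr : 0 < r)
    (hrγ : r ≤ γ) (h : ∫⁻ x in {x : ℝ | |x| ≤ 1}, ENNReal.ofReal (|x| ^ r) ∂Λ < ∞) :
    Integrable (cutoffPow γ) Λ := by
  have hS : MeasurableSet {x : ℝ | |x| ≤ 1} := measurableSet_le (by fun_prop) (by fun_prop)
  have h1 : IntegrableOn (fun x : ℝ => |x| ^ r) {x : ℝ | |x| ≤ 1} Λ := by
    refine ⟨(measurable_abs.pow_const r).aestronglyMeasurable, ?_⟩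
    rw [hasFiniteIntegral_iff_ofReal (ae_of_all _ fun x => by positivity)]
    exact h
  refine ((h1.integrable_indicator hS).add hΛ.integrable_min).mono' (by fun_prop)
    (ae_of_all _ fun x => ?_)
  rw [Real.norm_of_nonneg (cutoffPow_nonneg _ _)]
  simp only [cutoffPow, Pi.add_apply]
  by_cases hx : |x| ≤ 1
  · rw [if_pos hx, Set.indicator_of_mem (by exact hx)]
    have : |x| ^ γ ≤ |x| ^ r :=
      Real.rpow_le_rpow_of_exponent_ge' (abs_nonneg _) hx hr.le hrγ
    have : 0 ≤ min 1 (x ^ 2) := by positivity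
    linarith
  · rw [if_neg hx, Set.indicator_of_notMem (by exact hx), zero_add, le_min_iff]
    push Not at hx
    exact ⟨le_rfl, by rw [← sq_abs]; exact one_le_pow₀ hx.le⟩

lemma IsLevyMeasure.integrable_cutoffPow_two (hΛ : IsLevyMeasure Λ) :
    Integrable (cutoffPow 2) Λ :=
  hΛ.integrable_cutoffPow two_pos le_rfl hΛ.setLIntegral_rpow_two_lt_top

lemma IsLevyMeasure.integrable_levyIntegrand (hΛ : IsLevyMeasure Λ) (z : ℝ) :
    Integrable (levyIntegrand z) Λ :=
  (hΛ.integrable_cutoffPow_two.const_mul _).mono' (by fun_prop)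
    (ae_of_all _ fun x => norm_levyIntegrand_le one_le_two le_rfl z x)

lemma IsLevyMeasure.continuous_levyExponent (hΛ : IsLevyMeasure Λ) (a q : ℝ) :
    Continuous (levyExponent a q Λ) := by
  refine Continuous.add (by fun_prop) (continuous_iff_continuousAt.2 fun z₀ => ?_)
  refine continuousAt_of_dominated
    (bound := fun x => 2 * (1 + (|z₀| + 1) ^ (2 : ℝ)) * cutoffPow 2 x)
    (F := levyIntegrand) (Eventually.of_forall fun z => by fun_prop) ?_
    (hΛ.integrable_cutoffPow_two.const_mul _)
    (ae_of_all _ fun x => (continuous_levyIntegrand_left x).continuousAt)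
  have : ∀ᶠ z in 𝓝 z₀, |z| < |z₀| + 1 :=
    (continuous_abs.tendsto z₀).eventually_lt_const (lt_add_one _)
  filter_upwards [this] with z hz
  refine ae_of_all _ fun x => (norm_levyIntegrand_le one_le_two le_rfl z x).trans ?_
  have := cutoffPow_nonneg 2 x
  gcongr

/-- The drift forces `γ ≥ 1`, a Gaussian part forces `γ = 2`, and the jumps are controlled by the
integral of `cutoffPow γ`. -/
lemma exists_norm_levyExponent_le (a q : ℝ) {γ : ℝ} (h1 : 1 ≤ γ) (h2 : γ ≤ 2)
    (hq : q = 0 ∨ γ = 2) (hint : Integrable (cutoffPow γ) Λ) :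
    ∃ C : ℝ, 0 ≤ C ∧ ∀ z, ‖levyExponent a q Λ z‖ ≤ C * (1 + |z| ^ γ) := by
  have hH : 0 ≤ ∫ x, cutoffPow γ x ∂Λ := integral_nonneg (cutoffPow_nonneg γ)
  refine ⟨|a| + q ^ 2 / 2 + 2 * ∫ x, cutoffPow γ x ∂Λ, by positivity, fun z => ?_⟩
  have hz : 0 ≤ |z| ^ γ := by positivity
  have hza : |z| ≤ 1 + |z| ^ γ := by
    rcases le_total |z| 1 with h | h
    · linarith
    · have h3 : |z| ^ (1 : ℝ) ≤ |z| ^ γ := Real.rpow_le_rpow_of_exponent_le h h1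
      rw [Real.rpow_one] at h3
      linarith
  have hjump : ‖∫ x, levyIntegrand z x ∂Λ‖ ≤ 2 * (1 + |z| ^ γ) * ∫ x, cutoffPow γ x ∂Λ := by
    rw [← integral_const_mul]
    exact norm_integral_le_of_norm_le (hint.const_mul _)
      (ae_of_all _ fun x => norm_levyIntegrand_le h1 h2 z x)
  have hgauss : ‖(q : ℂ) ^ 2 / 2 * (z : ℂ) ^ 2‖ ≤ q ^ 2 / 2 * (1 + |z| ^ γ) := by
    rcases hq with rfl | rfl
    · simp
    · simp only [norm_mul, norm_div, norm_pow, Complex.norm_real, Real.norm_eq_abs, sq_abs,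
        Complex.norm_ofNat, Real.rpow_two]
      have : 0 ≤ q ^ 2 / 2 := by positivity
      nlinarith
  have hdrift : ‖Complex.I * a * z‖ ≤ |a| * (1 + |z| ^ γ) := by
    simp only [norm_mul, Complex.norm_I, one_mul, Complex.norm_real, Real.norm_eq_abs]
    gcongr
  rw [levyExponent_eq]
  refine (norm_add_le _ _).trans ?_
  have := norm_sub_le (Complex.I * a * z) ((q : ℂ) ^ 2 / 2 * (z : ℂ) ^ 2)
  linarith

/-- For finite `ν` the compensator is integrable on its own and is absorbed in the drift, leaving
drift + Gaussian + compound Poisson. -/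
lemma isDivExponent_levyExponent_of_isFiniteMeasure (a q : ℝ) (ν : Measure ℝ) [IsFiniteMeasure ν] :
    IsDivExponent (levyExponent a q ν) := by
  let c : ℝ → ℝ := fun x => x * (if |x| ≤ 1 then 1 else 0)
  have hc : Measurable c := Measurable.mul (by fun_prop)
    (Measurable.ite (measurableSet_le (by fun_prop) (by fun_prop)) (by fun_prop) (by fun_prop))
  have hcint : Integrable c ν := (integrable_const (1 : ℝ)).mono' hc.aestronglyMeasurable
    (ae_of_all _ fun x => by
      simp only [c]
      split_ifs with h
      · simpa using h
      · simp)
  have hexp : ∀ z : ℝ, Integrable (fun x : ℝ => Complex.exp (Complex.I * z * x) - 1) ν := fun z =>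
    (integrable_const (2 : ℝ)).mono' (by fun_prop)
      (ae_of_all _ (norm_exp_I_mul_mul_sub_one_le z))
  convert ((isDivExponent_dirac (a - ∫ x, c x ∂ν)).add (isDivExponent_gaussian q)).add
    (isDivExponent_compoundPoisson ν) using 2 with z
  have : ∀ x : ℝ, levyIntegrand z x =
      (Complex.exp (Complex.I * z * x) - 1) - Complex.I * z * (c x : ℂ) := fun x => by
    simp only [levyIntegrand, c]
    split_ifs <;> (push_cast; ring)
  rw [levyExponent_eq]
  simp only [this]
  have hcC : Integrable (fun x => (c x : ℂ)) ν := hcint.ofReal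
  rw [integral_sub (hexp z) (hcC.const_mul _), integral_const_mul, integral_complex_ofReal]
  push_cast
  ring

/-- **Lévy–Khintchine**: `levyExponent a q Λ` is the exponent of an infinitely divisible law. -/
theorem IsLevyMeasure.isDivExponent (hΛ : IsLevyMeasure Λ) (a q : ℝ) :
    IsDivExponent (levyExponent a q Λ) := by
  -- Jumps smaller than `1 / (n + 1)` are removed, which leaves a finite measure. As `n` grows only
  -- the point `0` is missed, where the integrand vanishes.
  let S : ℕ → Set ℝ := fun n => {x | 1 / ((n : ℝ) + 1) ≤ |x|}
  have hS : ∀ n, MeasurableSet (S n) := fun n => measurableSet_le (by fun_prop) (by fun_prop)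
  have hfin : ∀ n, IsFiniteMeasure (Λ.restrict (S n)) := fun n => ⟨by
    rw [Measure.restrict_apply_univ]
    have hpos : (0 : ℝ) < 1 / ((n : ℝ) + 1) := by positivity
    have hle : 1 / ((n : ℝ) + 1) ≤ 1 := by
      rw [div_le_one (by positivity)]
      linarith [(Nat.cast_nonneg n : (0 : ℝ) ≤ n)]
    refine lt_of_le_of_lt (measure_mono fun x hx => ?_)
      (hΛ.integrable_min.measure_ge_lt_top (ε := (1 / ((n : ℝ) + 1)) ^ 2) (by positivity))
    have hx' : 1 / ((n : ℝ) + 1) ≤ |x| := hx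
    refine le_min (pow_le_one₀ hpos.le hle) ?_
    rw [← sq_abs x]
    gcongr⟩
  refine IsDivExponent.of_tendsto (φ := fun n => levyExponent a q (Λ.restrict (S n)))
    (fun n => isDivExponent_levyExponent_of_isFiniteMeasure a q _) (fun z => ?_)
    (hΛ.continuous_levyExponent a q).continuousAt
  simp only [levyExponent_eq]
  refine tendsto_const_nhds.add ?_
  have hmono : Monotone S := fun m n hmn x hx => by
    have hx' : 1 / ((m : ℝ) + 1) ≤ |x| := hx
    refine le_trans ?_ hx'
    gcongr
  have hlim := tendsto_setIntegral_of_monotone (μ := Λ) hS hmono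
    (hΛ.integrable_levyIntegrand z).integrableOn
  rwa [setIntegral_eq_integral_of_forall_compl_eq_zero] at hlim
  intro x hx
  have : x = 0 := by
    by_contra h0
    obtain ⟨n, hn⟩ := exists_nat_one_div_lt (abs_pos.2 h0)
    exact hx (Set.mem_iUnion.2 ⟨n, hn.le⟩)
  simp [this, levyIntegrand]

/-- Admissibility yields a moment order `γ ∈ [1, 2]` with `p * γ < 1` that controls the
characteristic exponent. -/
lemma IsAdmissible.exists_exponent (a : ℝ) {p q : ℝ} (hΛ : IsLevyMeasure Λ)
    (hp : IsAdmissible p q Λ) :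
    ∃ γ C : ℝ, 1 ≤ γ ∧ p * γ < 1 ∧ 0 ≤ C ∧
      ∀ z, ‖levyExponent a q Λ z‖ ≤ C * (1 + |z| ^ γ) := by
  obtain ⟨hp0, hp1, hpb⟩ := hp
  have h2 := hΛ.setLIntegral_rpow_two_lt_top
  by_cases hq : q ^ 2 = 0
  · rw [bgIndex, if_pos hq, bgIndexMeasure, mul_comm, ← lt_div_iff₀ hp0] at hpb
    have hne : Set.Nonempty {r : ℝ | 0 < r ∧
        ∫⁻ x in {x : ℝ | |x| ≤ 1}, ENNReal.ofReal (|x| ^ r) ∂Λ < ∞} := ⟨2, two_pos, h2⟩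
    obtain ⟨r, ⟨hr0, hr⟩, hrp⟩ := exists_lt_of_csInf_lt hne hpb
    rw [lt_div_iff₀ hp0, mul_comm] at hrp
    -- The growth bound requires `1 ≤ γ ≤ 2`, so `r` is clamped to this interval; `p * γ < 1`
    -- survives because `p < 1` and `p * r < 1`.
    rcases le_total r 2 with hr2 | hr2
    · obtain ⟨C, hC⟩ := exists_norm_levyExponent_le a q (le_max_left 1 r)
        (max_le one_le_two hr2) (Or.inl (by simpa using hq))
        (hΛ.integrable_cutoffPow hr0 (le_max_right 1 r) hr)
      refine ⟨max 1 r, C, le_max_left _ _, ?_, hC⟩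
      rcases max_choice 1 r with h | h <;> rw [h] <;> linarith
    · obtain ⟨C, hC⟩ := exists_norm_levyExponent_le a q one_le_two le_rfl
        (Or.inr rfl) hΛ.integrable_cutoffPow_two
      exact ⟨2, C, one_le_two, by nlinarith, hC⟩
  · rw [bgIndex, if_neg hq] at hpb
    obtain ⟨C, hC⟩ := exists_norm_levyExponent_le a q one_le_two le_rfl
      (Or.inr rfl) hΛ.integrable_cutoffPow_two
    exact ⟨2, C, one_le_two, hpb, hC⟩

end LevyExponent

/-! ### Moments of the Yule process -/

section Yule

open Filter Topology

/-- **Minkowski's inequality** for countable sums. -/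
lemma lintegral_rpow_tsum_le {α : Type*} [MeasurableSpace α] {μ : Measure α} {f : ℕ → α → ℝ≥0∞}
    (hf : ∀ n, Measurable (f n)) {p : ℝ} (hp : 1 ≤ p) :
    (∫⁻ a, (∑' n, f n a) ^ p ∂μ) ^ (1 / p) ≤ ∑' n, (∫⁻ a, f n a ^ p ∂μ) ^ (1 / p) := by
  have hp0 : 0 < p := by linarith
  have hfin : ∀ m, (∫⁻ a, (∑ n ∈ Finset.range m, f n a) ^ p ∂μ) ^ (1 / p) ≤
      ∑ n ∈ Finset.range m, (∫⁻ a, f n a ^ p ∂μ) ^ (1 / p) := by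
    intro m
    induction m with
    | zero => simp [hp0]
    | succ m ih =>
      simp only [Finset.sum_range_succ]
      refine (ENNReal.lintegral_Lp_add_le (f := fun a => ∑ n ∈ Finset.range m, f n a) (g := f m)
        (by fun_prop) (hf m).aemeasurable hp).trans ?_
      gcongr
  have hlim : Tendsto (fun m => ∫⁻ a, (∑ n ∈ Finset.range m, f n a) ^ p ∂μ) atTop
      (𝓝 (∫⁻ a, (∑' n, f n a) ^ p ∂μ)) := by
    refine lintegral_tendsto_of_tendsto_of_monotone (fun m => by fun_prop)
      (ae_of_all _ fun a m m' hm => ?_) (ae_of_all _ fun a => ?_)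
    · dsimp only
      gcongr
    · exact (ENNReal.continuous_rpow_const.tendsto _).comp (ENNReal.tendsto_nat_tsum _)
  exact le_of_tendsto ((ENNReal.continuous_rpow_const.tendsto _).comp hlim)
    (Eventually.of_forall fun m => (hfin m).trans (ENNReal.sum_le_tsum _))

instance isProbabilityMeasure_expMeasure_succ (k : ℕ) :
    IsProbabilityMeasure (expMeasure ((k : ℝ) + 1)) :=
  isProbabilityMeasure_expMeasure (by positivity)

/-- The law of the holding times of the standard Yule process. -/
noncomputable abbrev holdingMeasure : Measure (ℕ → ℝ) :=
  Measure.infinitePi fun k : ℕ => expMeasure ((k : ℝ) + 1)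

@[fun_prop]
lemma measurable_yuleJumpTime (n : ℕ) : Measurable fun e : ℕ → ℝ => yuleJumpTime e n := by
  unfold yuleJumpTime
  fun_prop

/-- Induction step for the law of the jump times: `y` is the last holding time, of rate `n + 2`. For
`y > r`, `ENNReal.ofReal` truncates the integrand to `0`. -/
lemma lintegral_expMeasure_convolution_le (n : ℕ) (r : ℝ) :
    ∫⁻ y, ENNReal.ofReal (1 - Real.exp (-(r - y))) ^ (n + 1) ∂(expMeasure ((n : ℝ) + 2)) ≤
      ENNReal.ofReal (1 - Real.exp (-r)) ^ (n + 2) := by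
  have hdens : expMeasure ((n : ℝ) + 2) = volume.withDensity (exponentialPDF ((n : ℝ) + 2)) := rfl
  have hmeas : Measurable (exponentialPDF ((n : ℝ) + 2)) :=
    (measurable_exponentialPDFReal _).ennreal_ofReal
  rw [hdens, lintegral_withDensity_eq_lintegral_mul _ hmeas (by fun_prop)]
  -- Moving powers of `exp (-y)` from the density into the bracket turns the integrand into the
  -- exact derivative of `-(exp (-y) - exp (-r)) ^ (n + 2)`.
  let h : ℝ → ℝ := fun y =>
    ((n : ℝ) + 2) * Real.exp (-y) * (Real.exp (-y) - Real.exp (-r)) ^ (n + 1)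
  have hle : ∀ y, (exponentialPDF ((n : ℝ) + 2) *
      fun y => ENNReal.ofReal (1 - Real.exp (-(r - y))) ^ (n + 1)) y ≤
      (Set.Icc 0 r).indicator (fun y => ENNReal.ofReal (h y)) y := by
    intro y
    simp only [Pi.mul_apply]
    by_cases hy : y ∈ Set.Icc 0 r
    · have h1 : 0 ≤ 1 - Real.exp (-(r - y)) := by
        have : Real.exp (-(r - y)) ≤ 1 := Real.exp_le_one_iff.2 (by linarith [hy.2])
        linarith
      rw [Set.indicator_of_mem hy, exponentialPDF_of_nonneg hy.1, ← ENNReal.ofReal_pow h1,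
        ← ENNReal.ofReal_mul (by positivity)]
      refine (congrArg ENNReal.ofReal ?_).le
      have h2 : Real.exp (-y) - Real.exp (-r) = Real.exp (-y) * (1 - Real.exp (-(r - y))) := by
        rw [mul_sub, ← Real.exp_add, mul_one]
        ring_nf
      have h3 : Real.exp (-(((n : ℝ) + 2) * y)) = Real.exp (-y) ^ (n + 2) := by
        rw [← Real.exp_nat_mul]
        push_cast
        ring_nf
      simp only [h]
      rw [h2, h3, mul_pow]
      ring
    · rw [Set.indicator_of_notMem hy, nonpos_iff_eq_zero, mul_eq_zero]
      rw [Set.mem_Icc, not_and_or, not_le, not_le] at hy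
      rcases hy with hy | hy
      · exact Or.inl (exponentialPDF_of_neg hy)
      · refine Or.inr (pow_eq_zero_iff (by simp) |>.2 (ENNReal.ofReal_of_nonpos ?_))
        have : 1 ≤ Real.exp (-(r - y)) := Real.one_le_exp (by linarith)
        linarith
  refine (lintegral_mono hle).trans ?_
  rw [lintegral_indicator measurableSet_Icc]
  rcases lt_or_ge r 0 with hr | hr
  · rw [Set.Icc_eq_empty (by linarith)]
    simp
  have hcont : Continuous h := by fun_prop
  have hnonneg : ∀ y ∈ Set.Icc 0 r, 0 ≤ h y := fun y hy => by
    have : Real.exp (-r) ≤ Real.exp (-y) := Real.exp_le_exp.2 (by linarith [hy.2])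
    have : 0 ≤ Real.exp (-y) - Real.exp (-r) := by linarith
    simp only [h]
    positivity
  rw [← ofReal_integral_eq_lintegral_ofReal hcont.integrableOn_Icc
    ((ae_restrict_iff' measurableSet_Icc).2 (ae_of_all _ hnonneg)), integral_Icc_eq_integral_Ioc,
    ← intervalIntegral.integral_of_le hr]
  have hderiv : ∀ y ∈ Set.uIcc 0 r,
      HasDerivAt (fun y => -(Real.exp (-y) - Real.exp (-r)) ^ (n + 2)) (h y) y := fun y _ => by
    have h1 : HasDerivAt (fun y => Real.exp (-y) - Real.exp (-r)) (-Real.exp (-y)) y := by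
      simpa using ((hasDerivAt_neg y).exp).sub_const (Real.exp (-r))
    refine (h1.pow (n + 2)).neg.congr_deriv ?_
    simp only [h]
    push_cast
    ring
  rw [intervalIntegral.integral_eq_sub_of_hasDerivAt hderiv (hcont.intervalIntegrable _ _)]
  have h1 : 0 ≤ 1 - Real.exp (-r) := by
    have : Real.exp (-r) ≤ 1 := Real.exp_le_one_iff.2 (by linarith)
    linarith
  rw [← ENNReal.ofReal_pow h1]
  simp

/-- The `n`-th jump time of the Yule process is distributed as the maximum of `n + 1` independent
standard exponential variables. -/
lemma holdingMeasure_yuleJumpTime_le (n : ℕ) (r : ℝ) :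
    holdingMeasure {e | yuleJumpTime e n ≤ r} ≤ ENNReal.ofReal (1 - Real.exp (-r)) ^ (n + 1) := by
  induction n generalizing r with
  | zero =>
    have h1 : {e : ℕ → ℝ | yuleJumpTime e 0 ≤ r} = (fun e : ℕ → ℝ => e 0) ⁻¹' Set.Iic r := by
      ext e
      simp [yuleJumpTime]
    have hP : IsProbabilityMeasure (expMeasure 1) := isProbabilityMeasure_expMeasure one_pos
    rw [h1, ← Measure.map_apply (by fun_prop) measurableSet_Iic, Measure.infinitePi_map_eval]
    simp only [Nat.cast_zero, zero_add, pow_one]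
    rw [← ofReal_cdf, cdf_expMeasure_eq one_pos]
    split_ifs <;> simp
  | succ n ih =>
    have hind : IndepFun (fun e : ℕ → ℝ => yuleJumpTime e n) (fun e => e (n + 1))
        holdingMeasure := by
      have h := (iIndepFun_infinitePi (P := fun k : ℕ => expMeasure ((k : ℝ) + 1))
        (X := fun _ x => x) (fun _ => measurable_id)).indepFun_finsetSum_of_notMem
        (fun i => by fun_prop) (s := Finset.range (n + 1)) (i := n + 1) (by simp)
      convert h using 1
      ext e
      simp [yuleJumpTime]
    have hmap := hind.map_prod_eq_prod_map_map (by fun_prop) (measurable_pi_apply _).aemeasurable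
    rw [Measure.infinitePi_map_eval] at hmap
    have hset : {e : ℕ → ℝ | yuleJumpTime e (n + 1) ≤ r} =
        (fun e : ℕ → ℝ => (yuleJumpTime e n, e (n + 1))) ⁻¹' {x : ℝ × ℝ | x.1 + x.2 ≤ r} := by
      ext e
      simp [yuleJumpTime, Finset.sum_range_succ]
    have hS : MeasurableSet {x : ℝ × ℝ | x.1 + x.2 ≤ r} :=
      measurableSet_le (by fun_prop) (by fun_prop)
    have hP : IsProbabilityMeasure (holdingMeasure.map fun e => yuleJumpTime e n) :=
      Measure.isProbabilityMeasure_map (by fun_prop)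
    rw [hset, ← Measure.map_apply (by fun_prop) hS, hmap, Measure.prod_apply_symm hS]
    have hrate : ((n + 1 : ℕ) : ℝ) + 1 = (n : ℝ) + 2 := by
      push_cast
      ring
    rw [hrate]
    refine (lintegral_mono fun y => ?_).trans (lintegral_expMeasure_convolution_le n r)
    rw [Measure.map_apply (by fun_prop) (measurable_prodMk_right hS)]
    refine le_trans (le_of_eq (congrArg _ ?_)) (ih (r - y))
    ext e
    simp [le_sub_iff_add_le]

/-- Valid for infinite sets too, since `ncard` and `ENNReal.toReal ∞` both default to `0`. It makes
`yule` measurable everywhere, null set included. -/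
lemma natCast_ncard_eq_toReal_tsum (s : Set ℕ) :
    (s.ncard : ℝ) = (∑' n, s.indicator (fun _ => (1 : ℝ≥0∞)) n).toReal := by
  rw [← tsum_subtype, ENNReal.tsum_set_one]
  rcases s.finite_or_infinite with h | h
  · rw [← h.cast_ncard_eq]
    simp
  · simp [h.ncard, h.encard_eq]

lemma natCast_ncard_le_tsum (s : Set ℕ) :
    (s.ncard : ℝ≥0∞) ≤ ∑' n, s.indicator (fun _ => (1 : ℝ≥0∞)) n := by
  rw [← tsum_subtype, ENNReal.tsum_set_one]
  exact_mod_cast s.ncard_le_encard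

lemma measurable_yule : Measurable fun x : (ℕ → ℝ) × ℝ => (yule x.1 x.2 : ℝ) := by
  have h : ∀ n : ℕ, Measurable fun x : (ℕ → ℝ) × ℝ =>
      {n : ℕ | yuleJumpTime x.1 n ≤ x.2}.indicator (fun _ => (1 : ℝ≥0∞)) n := fun n => by
    simp only [Set.indicator_apply, Set.mem_ofPred_eq]
    exact Measurable.ite (measurableSet_le (by fun_prop) (by fun_prop)) measurable_const
      measurable_const
  simp only [yule, Nat.cast_add, natCast_ncard_eq_toReal_tsum]
  exact measurable_const.add (Measurable.tsum h).ennreal_toReal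

/-- `Z_r` is `1` plus a sum of indicators of jump times, whose `L^γ` norms are at most `(1 -
e^{-r})^{(n+1)/γ}`; Minkowski's inequality leaves a geometric series. -/
lemma lintegral_yule_rpow_le {γ : ℝ} (hγ : 1 ≤ γ) {r : ℝ} (hr : 0 ≤ r) :
    ∫⁻ e, (yule e r : ℝ≥0∞) ^ γ ∂holdingMeasure ≤ ENNReal.ofReal (γ * Real.exp r) ^ γ := by
  have hγ0 : 0 < γ := by linarith
  let f : ℕ → (ℕ → ℝ) → ℝ≥0∞ := fun n e =>
    Nat.casesOn n 1 fun n => {n : ℕ | yuleJumpTime e n ≤ r}.indicator (fun _ => (1 : ℝ≥0∞)) n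
  have hf : ∀ n, Measurable (f n) := by
    rintro (_ | n)
    · exact measurable_const
    · simp only [f, Set.indicator_apply, Set.mem_ofPred_eq]
      exact Measurable.ite (measurableSet_le (by fun_prop) (by fun_prop))
        measurable_const measurable_const
  have hle : ∀ e, (yule e r : ℝ≥0∞) ≤ ∑' n, f n e := fun e => by
    rw [tsum_eq_zero_add' ENNReal.summable, yule, Nat.cast_add, Nat.cast_one]
    exact add_le_add_right (natCast_ncard_le_tsum _) _
  set x : ℝ := Real.exp (-r) with hx
  have hx0 : 0 < x := Real.exp_pos _
  have hx1 : x ≤ 1 := Real.exp_le_one_iff.2 (by linarith)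
  have hfint : ∀ n, ∫⁻ e, f n e ^ γ ∂holdingMeasure ≤ ENNReal.ofReal (1 - x) ^ n := by
    rintro (_ | n)
    · simp [f]
    · refine le_trans (le_of_eq ?_) (holdingMeasure_yuleJumpTime_le n r)
      rw [← lintegral_indicator_one (measurableSet_le (by fun_prop) (by fun_prop))]
      refine lintegral_congr fun e => ?_
      by_cases h : yuleJumpTime e n ≤ r <;> simp [f, Set.indicator, h, hγ0]
  have hsum : ∑' n, (∫⁻ e, f n e ^ γ ∂holdingMeasure) ^ (1 / γ) ≤
      ENNReal.ofReal (γ * Real.exp r) := calc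
    _ ≤ ∑' n, (ENNReal.ofReal (1 - x) ^ (1 / γ)) ^ n := by
      refine ENNReal.tsum_le_tsum fun n => ?_
      rw [← ENNReal.rpow_mul_natCast, mul_comm, ENNReal.rpow_natCast_mul]
      gcongr
      exact hfint n
    _ = (1 - ENNReal.ofReal (1 - x) ^ (1 / γ))⁻¹ := ENNReal.tsum_geometric _
    _ ≤ (ENNReal.ofReal (x / γ))⁻¹ := by
      gcongr
      rw [ENNReal.ofReal_rpow_of_nonneg (by linarith) (by positivity), ← ENNReal.ofReal_one,
        ← ENNReal.ofReal_sub _ (Real.rpow_nonneg (by linarith) _)]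
      refine ENNReal.ofReal_le_ofReal ?_
      -- Bernoulli: `(1 - x) ^ (1 / γ) ≤ 1 - x / γ`, so the geometric series is at most `γ / x = γ
      -- e^r`.
      have := rpow_one_add_le_one_add_mul_self (s := -x) (p := 1 / γ) (by linarith)
        (by positivity) (by rw [div_le_one hγ0]; exact hγ)
      rw [← sub_eq_add_neg] at this
      have h2 : 1 / γ * -x = -(x / γ) := by ring
      linarith
    _ = ENNReal.ofReal (γ * Real.exp r) := by
      rw [← ENNReal.ofReal_inv_of_pos (by positivity), inv_div, hx, Real.exp_neg, div_inv_eq_mul]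
  have hmain := (lintegral_rpow_tsum_le (μ := holdingMeasure) hf hγ).trans hsum
  calc ∫⁻ e, (yule e r : ℝ≥0∞) ^ γ ∂holdingMeasure
      ≤ ∫⁻ e, (∑' n, f n e) ^ γ ∂holdingMeasure := by
        refine lintegral_mono fun e => ?_
        have := hle e
        dsimp only
        gcongr
    _ = ((∫⁻ e, (∑' n, f n e) ^ γ ∂holdingMeasure) ^ (1 / γ)) ^ γ := by
        rw [← ENNReal.rpow_mul, one_div_mul_cancel hγ0.ne', ENNReal.rpow_one]
    _ ≤ _ := by gcongr

end Yule

/-! ### Yule–Simon process: scaling and integrability -/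

section YuleSimon

open Filter Topology

lemma measurable_yuleSimon (p t : ℝ) : Measurable fun ω : YuleSpace => (yuleSimon p t ω : ℝ) := by
  have h : Measurable fun ω : YuleSpace =>
      (yule ω.2 (p * (Real.log t - Real.log ω.1)) : ℝ) :=
    measurable_yule.comp (g := fun x : (ℕ → ℝ) × ℝ => (yule x.1 x.2 : ℝ))
      (f := fun ω : YuleSpace => (ω.2, p * (Real.log t - Real.log ω.1))) (by fun_prop)
  have hS : MeasurableSet {ω : YuleSpace | ω.1 ≤ t} := measurableSet_le (by fun_prop) (by fun_prop)
  simp only [yuleSimon, Nat.cast_ite, Nat.cast_zero]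
  exact Measurable.ite hS h measurable_const

/-- The product of Lebesgue measure on `(0, ∞)` (the birth times) and the law of the holding
times. -/
noncomputable def birthMeasure : Measure YuleSpace :=
  ((volume : Measure ℝ).restrict (Set.Ioi 0)).prod holdingMeasure

lemma birthMeasure_restrict (T : ℝ) :
    birthMeasure.restrict {ω | ω.1 ≤ T} =
      ((volume : Measure ℝ).restrict (Set.Ioc 0 T)).prod holdingMeasure := by
  have h : {ω : YuleSpace | ω.1 ≤ T} = Set.Iic T ×ˢ Set.univ := by
    ext ω
    simp
  rw [birthMeasure, h, ← Measure.prod_restrict, Measure.restrict_univ,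
    Measure.restrict_restrict measurableSet_Iic, Set.Iic_inter_Ioi]

/-- At `r = p log (s / v)` the Yule moment bound is `γ^γ (s / v)^(pγ)`, integrable near `v = 0`
exactly because `pγ < 1`. -/
lemma memLp_yuleSimon {p γ : ℝ} (hp : 0 < p) (hγ : 1 ≤ γ) (hpγ : p * γ < 1) (s : ℝ) :
    MemLp (fun ω => (yuleSimon p s ω : ℝ)) (ENNReal.ofReal γ) birthMeasure := by
  have hγ0 : 0 < γ := by linarith
  have hmeas := measurable_yuleSimon p s
  refine ⟨hmeas.aestronglyMeasurable, ?_⟩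
  rw [eLpNorm_lt_top_iff_lintegral_rpow_enorm_lt_top (by simpa using hγ0) ENNReal.ofReal_ne_top,
    ENNReal.toReal_ofReal hγ0.le, birthMeasure, 
    lintegral_prod _ (hmeas.enorm.pow_const γ).aemeasurable]
  have hbound : ∀ v ∈ Set.Ioi (0 : ℝ),
      ∫⁻ e, ‖(yuleSimon p s (v, e) : ℝ)‖ₑ ^ γ ∂holdingMeasure ≤ (Set.Ioc 0 s).indicator
        (fun v => ENNReal.ofReal (γ ^ γ * s ^ (p * γ) * v ^ (-(p * γ)))) v := by
    intro v hv
    have hv : 0 < v := hv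
    by_cases hvs : v ≤ s
    · have hs : 0 < s := hv.trans_le hvs
      rw [Set.indicator_of_mem (show v ∈ Set.Ioc 0 s from ⟨hv, hvs⟩)]
      have hr : 0 ≤ p * (Real.log s - Real.log v) :=
        mul_nonneg hp.le (sub_nonneg.2 (Real.log_le_log hv hvs))
      refine le_trans (le_of_eq ?_) ((lintegral_yule_rpow_le hγ hr).trans (le_of_eq ?_))
      · simp [yuleSimon, hvs]
      · rw [ENNReal.ofReal_rpow_of_nonneg (by positivity) hγ0.le,
          Real.mul_rpow hγ0.le (Real.exp_pos _).le, ← Real.exp_mul, Real.rpow_def_of_pos hs,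
          Real.rpow_def_of_pos hv, mul_assoc (γ ^ γ), ← Real.exp_add]
        ring_nf
    · simp [yuleSimon, hvs, hγ0]
  refine lt_of_le_of_lt (setLIntegral_mono' measurableSet_Ioi hbound) ?_
  rw [lintegral_indicator measurableSet_Ioc, Measure.restrict_restrict measurableSet_Ioc]
  rw [Set.inter_eq_left.2 Set.Ioc_subset_Ioi_self]
  rcases lt_or_ge s 0 with hs | hs
  · rw [Set.Ioc_eq_empty (by linarith)]
    simp
  have hint : IntegrableOn (fun v : ℝ => γ ^ γ * s ^ (p * γ) * v ^ (-(p * γ))) (Set.Ioc 0 s) := by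
    have := (intervalIntegral.intervalIntegrable_rpow' (a := 0) (b := s) (r := -(p * γ))
      (by linarith)).const_mul (γ ^ γ * s ^ (p * γ))
    rwa [intervalIntegrable_iff_integrableOn_Ioc_of_le hs] at this
  exact hint.setLIntegral_lt_top

lemma map_yuleMeasure_mul {t : ℝ} (ht : 0 < t) :
    yuleMeasure.map (fun ω => (t * ω.1, ω.2)) =
      ENNReal.ofReal t⁻¹ • birthMeasure.restrict {ω | ω.1 ≤ t} := by
  have h1 : ((volume : Measure ℝ).restrict (Set.Icc 0 1)).map (fun u => t * u) =
      ENNReal.ofReal t⁻¹ • (volume : Measure ℝ).restrict (Set.Ioc 0 t) := by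
    rw [Measure.restrict_congr_set Ioc_ae_eq_Icc.symm]
    have hpre : Set.Ioc (0 : ℝ) 1 = (fun u => t * u) ⁻¹' Set.Ioc 0 t := by
      ext u
      simp only [Set.mem_Ioc, Set.mem_preimage]
      constructor
      · rintro ⟨h0, h1⟩
        exact ⟨by positivity, by nlinarith⟩
      · rintro ⟨h0, h1⟩
        exact ⟨pos_of_mul_pos_right h0 ht.le, by nlinarith⟩
    rw [hpre, ← Measure.restrict_map (by fun_prop) measurableSet_Ioc,
      Real.map_volume_mul_left ht.ne', Measure.restrict_smul, abs_of_pos (inv_pos.2 ht)]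
  have h2 : (fun ω : YuleSpace => (t * ω.1, ω.2)) = Prod.map (fun u => t * u) id := rfl
  rw [yuleMeasure, h2, ← Measure.map_prod_map _ _ (by fun_prop) measurable_id, Measure.map_id,
    h1, Measure.prod_smul_left, birthMeasure_restrict]

lemma ae_yuleMeasure_pos : ∀ᵐ ω ∂yuleMeasure, 0 < ω.1 := by
  have h : ∀ᵐ u ∂((volume : Measure ℝ).restrict (Set.Icc 0 1)), 0 < u := by
    rw [Measure.restrict_congr_set Ioc_ae_eq_Icc.symm]
    exact (ae_restrict_iff' measurableSet_Ioc).2 (ae_of_all _ fun _ h => h.1)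
  exact Measure.quasiMeasurePreserving_fst.ae h

instance : IsProbabilityMeasure yuleMeasure := by
  have : IsProbabilityMeasure ((volume : Measure ℝ).restrict (Set.Icc 0 1)) := ⟨by simp⟩
  unfold yuleMeasure
  infer_instance

/-- `log (s / t) - log u = log s - log (t u)`. Positivity of `u` also gives `s > 0` on the event `u
≤ s / t`, so the logarithms are genuine. -/
lemma yuleSimon_div {p s t : ℝ} (ht : 0 < t) {ω : YuleSpace} (hω : 0 < ω.1) :
    yuleSimon p (s / t) ω = yuleSimon p s (t * ω.1, ω.2) := by
  have hiff : ω.1 ≤ s / t ↔ t * ω.1 ≤ s := by rw [le_div_iff₀ ht, mul_comm]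
  by_cases h : ω.1 ≤ s / t
  · have h' := hiff.1 h
    have hs' : 0 < s := lt_of_lt_of_le (by positivity) h'
    simp only [yuleSimon, if_pos h, if_pos h']
    rw [Real.log_div hs'.ne' ht.ne', Real.log_mul ht.ne' hω.ne']
    congr 2
    ring
  · have h' := fun h' => h (hiff.2 h')
    simp only [yuleSimon, if_neg h, if_neg h']

variable {ι : Type*} [Fintype ι]

/-- The linear combination `∑ i, l i * Y (s i)` of values of the Yule–Simon process. -/
noncomputable def yuleSum (p : ℝ) (l : ι → ℝ) (s : ι → ℝ≥0) (ω : YuleSpace) : ℝ :=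
  ∑ i, l i * (yuleSimon p (s i) ω : ℝ)

lemma measurable_yuleSum (p : ℝ) (l : ι → ℝ) (s : ι → ℝ≥0) : Measurable (yuleSum p l s) :=
  Finset.measurable_sum _ fun i _ => (measurable_yuleSimon p (s i)).const_mul _

lemma yuleSum_eq_zero {p : ℝ} {l : ι → ℝ} {s : ι → ℝ≥0} {t : ℝ≥0} (hs : ∀ i, s i ≤ t)
    {ω : YuleSpace} (hω : ω ∉ {ω : YuleSpace | ω.1 ≤ t}) : yuleSum p l s ω = 0 := by
  refine Finset.sum_eq_zero fun i _ => ?_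
  have h : ¬ ω.1 ≤ s i := fun h => hω (h.trans (by exact_mod_cast hs i))
  simp [yuleSimon, h]

lemma ae_sum_yuleSimon_div (p : ℝ) (l : ι → ℝ) (s : ι → ℝ≥0) {t : ℝ≥0} (ht : 0 < t) :
    ∀ᵐ ω ∂yuleMeasure, ∑ i, l i * (yuleSimon p ((s i : ℝ) / t) ω : ℝ) =
      yuleSum p l s (t * ω.1, ω.2) := by
  filter_upwards [ae_yuleMeasure_pos] with ω hω
  refine Finset.sum_congr rfl fun i _ => ?_
  rw [yuleSimon_div (NNReal.coe_pos.2 ht) hω]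

/-- Scaling of the birth times removes the normalisation by `t`. -/
lemma mul_integral_yuleSimon_div {Ψ : ℝ → ℂ} (hΨ : Measurable Ψ) (h0 : Ψ 0 = 0) (p : ℝ)
    (l : ι → ℝ) (s : ι → ℝ≥0) {t : ℝ≥0} (ht : 0 < t) (hs : ∀ i, s i ≤ t) :
    (t : ℝ) * ∫ ω, Ψ (∑ i, l i * (yuleSimon p ((s i : ℝ) / t) ω : ℝ)) ∂yuleMeasure =
      ∫ ω, Ψ (yuleSum p l s ω) ∂birthMeasure := by
  have ht' : (0 : ℝ) < t := ht
  have hm : Measurable fun ω => Ψ (yuleSum p l s ω) := hΨ.comp (measurable_yuleSum p l s)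
  have h1 : ∫ ω, Ψ (∑ i, l i * (yuleSimon p ((s i : ℝ) / t) ω : ℝ)) ∂yuleMeasure =
      ∫ ω, Ψ (yuleSum p l s ω) ∂(yuleMeasure.map fun ω => ((t : ℝ) * ω.1, ω.2)) := by
    rw [integral_map (by fun_prop) hm.aestronglyMeasurable]
    refine integral_congr_ae ?_
    filter_upwards [ae_sum_yuleSimon_div p l s ht] with ω hω
    rw [hω]
  -- The factor `t` cancels the density `1 / t` of the birth time, and the restriction to births
  -- before `t` can be dropped because later ones give `Ψ 0 = 0`.
  rw [h1, map_yuleMeasure_mul ht', integral_smul_measure,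
    setIntegral_eq_integral_of_forall_compl_eq_zero
      (fun ω hω => by rw [yuleSum_eq_zero hs hω, h0]),
    ENNReal.toReal_ofReal (by positivity), Complex.real_smul, ← mul_assoc]
  push_cast
  rw [mul_inv_cancel₀ (by exact_mod_cast ht'.ne'), one_mul]

lemma integrable_yuleSimon_div {Ψ : ℝ → ℂ} (hΨ : Measurable Ψ) {p : ℝ}
    {l : ι → ℝ} {s : ι → ℝ≥0} {t : ℝ≥0} (ht : 0 < t)
    (h : IntegrableOn (fun ω => Ψ (yuleSum p l s ω)) {ω | ω.1 ≤ t} birthMeasure) :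
    Integrable (fun ω => Ψ (∑ i, l i * (yuleSimon p ((s i : ℝ) / t) ω : ℝ))) yuleMeasure := by
  have hm : Measurable fun ω => Ψ (yuleSum p l s ω) := hΨ.comp (measurable_yuleSum p l s)
  have h1 : Integrable (fun ω => Ψ (yuleSum p l s ω))
      (yuleMeasure.map fun ω => ((t : ℝ) * ω.1, ω.2)) := by
    rw [map_yuleMeasure_mul (NNReal.coe_pos.2 ht)]
    exact h.smul_measure ENNReal.ofReal_ne_top
  rw [integrable_map_measure hm.aestronglyMeasurable (by fun_prop)] at h1
  refine h1.congr ?_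
  filter_upwards [ae_sum_yuleSimon_div p l s ht] with ω hω
  simp only [Function.comp_apply]
  rw [hω]

lemma memLp_yuleSum {p γ : ℝ} (hp : 0 < p) (hγ : 1 ≤ γ) (hpγ : p * γ < 1)
    (l : ι → ℝ) (s : ι → ℝ≥0) :
    MemLp (yuleSum p l s) (ENNReal.ofReal γ) birthMeasure :=
  memLp_finsetSum _ fun i _ => (memLp_yuleSimon hp hγ hpγ (s i)).const_mul _

lemma integrable_abs_yuleSum_rpow {p γ : ℝ} (hp : 0 < p) (hγ : 1 ≤ γ) (hpγ : p * γ < 1)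
    (l : ι → ℝ) (s : ι → ℝ≥0) :
    Integrable (fun ω => |yuleSum p l s ω| ^ γ) birthMeasure := by
  have hγ0 : 0 < γ := by linarith
  have := (memLp_yuleSum hp hγ hpγ l s).integrable_norm_rpow (by simpa using hγ0)
    ENNReal.ofReal_ne_top
  simpa only [ENNReal.toReal_ofReal hγ0.le, Real.norm_eq_abs] using this

lemma birthMeasure_setOf_le_lt_top (T : ℝ) : birthMeasure {ω | ω.1 ≤ T} < ∞ := by
  rw [← Measure.restrict_apply_univ, birthMeasure_restrict]
  exact measure_lt_top _ _

/-- The bounded time window is needed for the constant term of the growth bound, `birthMeasure`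
being infinite. -/
lemma integrableOn_comp_yuleSum {Ψ : ℝ → ℂ} (hΨ : Measurable Ψ) {p γ C : ℝ} (hp : 0 < p)
    (hγ : 1 ≤ γ) (hpγ : p * γ < 1) (hC : ∀ z, ‖Ψ z‖ ≤ C * (1 + |z| ^ γ))
    (l : ι → ℝ) (s : ι → ℝ≥0) (T : ℝ) :
    IntegrableOn (fun ω => Ψ (yuleSum p l s ω)) {ω | ω.1 ≤ T} birthMeasure := by
  have h1 : IntegrableOn (fun _ => (1 : ℝ)) {ω : YuleSpace | ω.1 ≤ T} birthMeasure :=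
    integrableOn_const (birthMeasure_setOf_le_lt_top T).ne
  exact ((h1.add (integrable_abs_yuleSum_rpow hp hγ hpγ l s).integrableOn).const_mul C).mono'
    (hΨ.comp (measurable_yuleSum p l s)).aestronglyMeasurable (ae_of_all _ fun ω => hC _)

end YuleSimon

/-! ### Finite-dimensional distributions -/

section FiniteDimensional

open Filter Topology InnerProductSpace

variable {ι : Type*} [Fintype ι]

lemma aestronglyMeasurable_exp_sum (l : ι → ℝ) (μ : Measure (ι → ℝ)) :
    AEStronglyMeasurable (fun x => Complex.exp (Complex.I * ((∑ i, l i * x i : ℝ) : ℂ))) μ := by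
  have h : Continuous fun x : ι → ℝ =>
      Complex.exp (Complex.I * ((∑ i, l i * x i : ℝ) : ℂ)) := by fun_prop
  exact h.measurable.aestronglyMeasurable

/-- A finite measure on `ι → ℝ` is determined by its characteristic function. -/
lemma measure_pi_ext_of_integral_exp {μ ν : Measure (ι → ℝ)} [IsFiniteMeasure μ]
    [IsFiniteMeasure ν]
    (h : ∀ l : ι → ℝ, ∫ x, Complex.exp (Complex.I * ((∑ i, l i * x i : ℝ) : ℂ)) ∂μ =
      ∫ x, Complex.exp (Complex.I * ((∑ i, l i * x i : ℝ) : ℂ)) ∂ν) : μ = ν := by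
  classical
  refine Measure.ext_of_charFunDual (funext fun L => ?_)
  have hL : ∀ x : ι → ℝ, L x = ∑ i, L (Pi.single i 1) * x i := fun x => by
    conv_lhs => rw [pi_eq_sum_univ' x]
    simp only [map_sum, map_smul, smul_eq_mul]
    exact Finset.sum_congr rfl fun i _ => mul_comm _ _
  have hcomm : ∀ x, Complex.exp (L x * Complex.I) =
      Complex.exp (Complex.I * ((∑ i, L (Pi.single i 1) * x i : ℝ) : ℂ)) := fun x => by
    rw [hL, mul_comm]
  simp only [charFunDual_apply, hcomm]
  exact h _

variable {Ψ : ℝ → ℂ} {p γ C : ℝ}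

/-- The linear combinations of the Yule–Simon process at finitely many times, integrated against an
infinitely divisible exponent, yield the exponent of an infinitely divisible law. -/
lemma isDivExponent_yuleSum (hΨ : IsDivExponent Ψ) (hcont : Continuous Ψ)
    (h0 : Ψ 0 = 0) (hp : 0 < p) (hγ : 1 ≤ γ) (hpγ : p * γ < 1) (hC0 : 0 ≤ C)
    (hC : ∀ z, ‖Ψ z‖ ≤ C * (1 + |z| ^ γ)) (s : ι → ℝ≥0) :
    IsDivExponent fun l : EuclideanSpace ℝ ι =>
      ∫ ω, Ψ (yuleSum p l s ω) ∂birthMeasure := by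
  -- Any horizon beyond all times would do; the `+ 1` keeps it positive when there are no times or
  -- all vanish.
  let t : ℝ≥0 := Finset.univ.sup s + 1
  have ht : 0 < t := by positivity
  have hs : ∀ i, s i ≤ t := fun i =>
    (Finset.le_sup (f := s) (Finset.mem_univ i)).trans (le_self_add)
  let Y : YuleSpace → EuclideanSpace ℝ ι := fun ω =>
    WithLp.toLp 2 fun i => (yuleSimon p ((s i : ℝ) / t) ω : ℝ)
  have hY : Measurable Y := (WithLp.measurable_toLp 2 _).comp
    (measurable_pi_lambda _ fun i => measurable_yuleSimon p _)
  have hinner : ∀ ω (l : EuclideanSpace ℝ ι),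
      ⟪Y ω, l⟫_ℝ = ∑ i, l i * (yuleSimon p ((s i : ℝ) / t) ω : ℝ) := fun ω l => by
    simp [Y, PiLp.inner_apply]
  have hγ0 : 0 ≤ γ := by linarith
  have hint : ∀ l : EuclideanSpace ℝ ι, Integrable (fun ω => Ψ ⟪Y ω, l⟫_ℝ) yuleMeasure :=
    fun l => by
      simp only [hinner]
      exact integrable_yuleSimon_div hcont.measurable ht
        (integrableOn_comp_yuleSum hcont.measurable hp hγ hpγ hC l s t)
  -- Dominating function for `‖l‖ < 1`, where `|⟪Y, l⟫| ≤ ∑ Yᵢ`; it is integrable by the previous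
  -- argument applied to `z ↦ C (1 + |z| ^ γ)` itself.
  have hdom : Integrable (fun ω => C * (1 + (∑ i, (yuleSimon p ((s i : ℝ) / t) ω : ℝ)) ^ γ))
      yuleMeasure := by
    have hmeas : Measurable fun z : ℝ => ((C * (1 + |z| ^ γ) : ℝ) : ℂ) := by fun_prop
    have hnorm : ∀ z : ℝ, ‖((C * (1 + |z| ^ γ) : ℝ) : ℂ)‖ ≤ C * (1 + |z| ^ γ) := fun z => by
      rw [Complex.norm_real, Real.norm_of_nonneg (by positivity)]
    have h1 := integrable_yuleSimon_div hmeas ht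
      (integrableOn_comp_yuleSum hmeas hp hγ hpγ hnorm (fun _ : ι => (1 : ℝ)) s t)
    refine h1.re.congr (ae_of_all _ fun ω => ?_)
    simp only [one_mul]
    rw [abs_of_nonneg (Finset.sum_nonneg fun i _ => Nat.cast_nonneg _)]
    simp only [RCLike.re_to_complex, Complex.ofReal_re]
  have hcont0 : ContinuousAt (fun l => ∫ ω, Ψ ⟪Y ω, l⟫_ℝ ∂yuleMeasure) 0 := by
    refine continuousAt_of_dominated (Eventually.of_forall fun l => (hint l).aestronglyMeasurable)
      ?_ hdom (ae_of_all _ fun ω => (hcont.comp (by fun_prop)).continuousAt)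
    filter_upwards [Metric.ball_mem_nhds (0 : EuclideanSpace ℝ ι) one_pos] with l hl
    refine ae_of_all _ fun ω => (hC _).trans ?_
    have hle : |⟪Y ω, l⟫_ℝ| ≤ ∑ i, (yuleSimon p ((s i : ℝ) / t) ω : ℝ) := by
      rw [hinner]
      refine (Finset.abs_sum_le_sum_abs _ _).trans (Finset.sum_le_sum fun i _ => ?_)
      rw [abs_mul, Nat.abs_cast]
      have h1 : ‖l i‖ ≤ ‖l‖ := PiLp.norm_apply_le l i
      rw [mem_ball_zero_iff] at hl
      rw [Real.norm_eq_abs] at h1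
      exact mul_le_of_le_one_left (Nat.cast_nonneg _) (by linarith)
    gcongr
  have hmix := (hΨ.mixture (m := yuleMeasure) hY hint hcont0).const_mul t.2
  convert hmix using 2 with l
  simp only [hinner]
  exact (mul_integral_yuleSimon_div hcont.measurable h0 p l s ht hs).symm

/-- Existence of the finite-dimensional distributions. -/
lemma exists_fdd (hΨ : IsDivExponent Ψ) (hcont : Continuous Ψ)
    (h0 : Ψ 0 = 0) (hp : 0 < p) (hp1 : p < 1) (hγ : 1 ≤ γ) (hpγ : p * γ < 1) (hC0 : 0 ≤ C)
    (hC : ∀ z, ‖Ψ z‖ ≤ C * (1 + |z| ^ γ)) (s : ι → ℝ≥0) :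
    ∃ μ : Measure (ι → ℝ), IsProbabilityMeasure μ ∧ ∀ l : ι → ℝ,
      ∫ x, Complex.exp (Complex.I * ((∑ i, l i * x i : ℝ) : ℂ)) ∂μ =
        Complex.exp ((1 - p) * ∫ ω, Ψ (yuleSum p l s ω) ∂birthMeasure) := by
  obtain ⟨μ, hμ, h⟩ :=
    isDivExponent_yuleSum hΨ hcont h0 hp hγ hpγ hC0 hC s (1 - p) (by linarith)
  refine ⟨μ.map WithLp.ofLp, Measure.isProbabilityMeasure_map (by fun_prop), fun l => ?_⟩
  have := h (WithLp.toLp 2 l)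
  rw [charFun_apply] at this
  rw [integral_map (by fun_prop) (aestronglyMeasurable_exp_sum _ _)]
  push_cast at this ⊢
  rw [← this]
  congr 1 with x
  rw [mul_comm]
  congr 2
  simp [PiLp.inner_apply]

end FiniteDimensional

/-! ### Construction of the process and uniqueness in law -/

section Extension

variable {T : Type*}

/-- Merging repeated times in a linear combination. -/
lemma exists_finset_sum_eq {k : Type*} [Fintype k] (l : k → ℝ) (s : k → T) :
    ∃ (J : Finset T) (m : J → ℝ), ∀ f : T → ℝ, ∑ i, l i * f (s i) = ∑ j : J, m j * f j := by
  classical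
  refine ⟨Finset.univ.image s, fun j => ∑ i with s i = j, l i, fun f => ?_⟩
  rw [Finset.sum_coe_sort (Finset.univ.image s) (fun j => (∑ i with s i = j, l i) * f j),
    ← Finset.sum_fiberwise_of_maps_to (g := s) (t := Finset.univ.image s)
      (fun i _ => Finset.mem_image_of_mem _ (Finset.mem_univ i))]
  refine Finset.sum_congr rfl fun j _ => ?_
  rw [Finset.sum_mul]
  refine Finset.sum_congr rfl fun i hi => ?_
  rw [(Finset.mem_filter.1 hi).2]

/-- Passing to a marginal amounts to setting the other coefficients of the characteristic function
to `0`; this is the consistency of the finite-dimensional laws. -/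
lemma sum_extend_mul {I J : Finset T} (hJI : J ⊆ I) [DecidableEq T] (l : J → ℝ) (f : I → ℝ) :
    ∑ i : I, (if h : i.1 ∈ J then l ⟨i, h⟩ else 0) * f i = ∑ j : J, l j * f ⟨j, hJI j.2⟩ := by
  symm
  refine Finset.sum_of_injOn (fun j : J => (⟨j, hJI j.2⟩ : I)) ?_ (by simp) ?_ ?_
  · intro a _ b _ h
    exact Subtype.ext (congrArg (fun x : I => x.1) h)
  · intro i _ hi
    rw [dif_neg, zero_mul]
    intro h
    exact hi ⟨⟨i, h⟩, by simp⟩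
  · intro j _
    simp

variable {Ψ : ℝ → ℂ} {p γ C : ℝ}

/-- Existence of a process on `[0, ∞)` with the prescribed finite-dimensional distributions. -/
theorem exists_process (hΨ : IsDivExponent Ψ) (hcont : Continuous Ψ)
    (h0 : Ψ 0 = 0) (hp : 0 < p) (hp1 : p < 1) (hγ : 1 ≤ γ) (hpγ : p * γ < 1) (hC0 : 0 ≤ C)
    (hC : ∀ z, ‖Ψ z‖ ≤ C * (1 + |z| ^ γ)) :
    ∃ μ : Measure (ℝ≥0 → ℝ), IsProbabilityMeasure μ ∧
      ∀ (k : ℕ) (l : Fin k → ℝ) (s : Fin k → ℝ≥0),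
        ∫ x, Complex.exp (Complex.I * ((∑ i, l i * x (s i) : ℝ) : ℂ)) ∂μ =
          Complex.exp ((1 - p) * ∫ ω, Ψ (yuleSum p l s ω) ∂birthMeasure) := by
  classical
  choose P hP hchar using fun J : Finset ℝ≥0 =>
    exists_fdd hΨ hcont h0 hp hp1 hγ hpγ hC0 hC (fun j : J => (j : ℝ≥0))
  have hproj : IsProjectiveMeasureFamily (α := fun _ : ℝ≥0 => ℝ) P := by
    intro I J hJI
    have hm : Measurable (Finset.restrict₂ (π := fun _ : ℝ≥0 => ℝ) hJI) :=
      Finset.measurable_restrict₂ hJI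
    have : IsProbabilityMeasure ((P I).map (Finset.restrict₂ (π := fun _ : ℝ≥0 => ℝ) hJI)) :=
      Measure.isProbabilityMeasure_map hm.aemeasurable
    refine measure_pi_ext_of_integral_exp fun l => ?_
    rw [integral_map hm.aemeasurable (aestronglyMeasurable_exp_sum _ _), hchar J]
    have h := hchar I fun i => if h : i.1 ∈ J then l ⟨i, h⟩ else 0
    simp only [yuleSum, sum_extend_mul hJI l] at h
    exact h.symm
  obtain ⟨μ, hμ⟩ := exists_isProjectiveLimit hproj
  refine ⟨μ, hμ.isProbabilityMeasure, fun k l s => ?_⟩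
  -- The times may repeat, whereas the projective family is indexed by finite sets.
  obtain ⟨J, m, hJ⟩ := exists_finset_sum_eq l s
  have h := hchar J m
  rw [← hμ J, integral_map (by fun_prop) (aestronglyMeasurable_exp_sum _ _)] at h
  have hsum : ∀ ω, yuleSum p l s ω = yuleSum p m (fun j : J => (j : ℝ≥0)) ω := fun ω =>
    hJ fun t => (yuleSimon p t ω : ℝ)
  simp only [hsum, hJ, ← h]
  rfl

/-- Two processes with the same finite-dimensional characteristic functions have the same law. -/
lemma identDistrib_of_integral_exp_eq {Ω Ω' : Type*} [MeasurableSpace Ω] [MeasurableSpace Ω']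
    {P : Measure Ω} {P' : Measure Ω'} [IsProbabilityMeasure P] [IsProbabilityMeasure P']
    {X : T → Ω → ℝ} {X' : T → Ω' → ℝ} (hX : ∀ t, Measurable (X t)) (hX' : ∀ t, Measurable (X' t))
    (h : ∀ (k : ℕ) (l : Fin k → ℝ) (s : Fin k → T),
      ∫ ω, Complex.exp (Complex.I * ((∑ i, l i * X (s i) ω : ℝ) : ℂ)) ∂P =
        ∫ ω, Complex.exp (Complex.I * ((∑ i, l i * X' (s i) ω : ℝ) : ℂ)) ∂P') :
    IdentDistrib (fun ω t => X t ω) (fun ω t => X' t ω) P P' := by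
  have hm : Measurable fun ω t => X t ω := measurable_pi_lambda _ hX
  have hm' : Measurable fun ω t => X' t ω := measurable_pi_lambda _ hX'
  refine ⟨hm.aemeasurable, hm'.aemeasurable, ?_⟩
  have hlim := isProjectiveLimit_map (P := P) (X := X) hm.aemeasurable
  have hlim' := isProjectiveLimit_map (P := P') (X := X') hm'.aemeasurable
  have heq : ∀ I : Finset T, P.map (fun ω => I.restrict fun t => X t ω) =
      P'.map fun ω => I.restrict fun t => X' t ω := by
    intro I
    have hI : Measurable fun ω => I.restrict fun t => X t ω :=
      (Finset.measurable_restrict I).comp hm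
    have hI' : Measurable fun ω => I.restrict fun t => X' t ω :=
      (Finset.measurable_restrict I).comp hm'
    have := Measure.isProbabilityMeasure_map (μ := P) hI.aemeasurable
    have := Measure.isProbabilityMeasure_map (μ := P') hI'.aemeasurable
    refine measure_pi_ext_of_integral_exp fun l => ?_
    rw [integral_map hI.aemeasurable (aestronglyMeasurable_exp_sum _ _),
      integral_map hI'.aemeasurable (aestronglyMeasurable_exp_sum _ _)]
    let e := (Fintype.equivFin I).symm
    have hsum : ∀ f : I → ℝ, ∑ i, l i * f i = ∑ i, l (e i) * f (e i) := fun f =>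
      (e.sum_comp fun i => l i * f i).symm
    simp only [hsum]
    exact h _ (fun i => l (e i)) fun i => (e i : T)
  have hfin : ∀ I : Finset T, IsFiniteMeasure (P'.map fun ω => I.restrict fun t => X' t ω) :=
    fun I => inferInstance
  have hlim'' : IsProjectiveLimit (P.map fun ω t => X t ω)
      fun I => P'.map fun ω => I.restrict fun t => X' t ω := fun I => (hlim I).trans (heq I)
  exact hlim''.unique hlim'

end Extension

end NoiseReinforced

/-! ### Noise reinforced Lévy processes on the half-line -/

theorem mainTheorem12 (a q : ℝ) (Λ : Measure ℝ) (hΛ : NoiseReinforced.IsLevyMeasure Λ)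
    (p : ℝ) (hp : NoiseReinforced.IsAdmissible p q Λ) :
    -- the expectations on the right-hand side are well defined
    (∀ (k : ℕ) (l : Fin k → ℝ) (s : Fin k → ℝ≥0) (t : ℝ≥0), 0 < t → (∀ i, s i ≤ t) →
      Integrable (NoiseReinforced.exponentAt a q Λ p l (fun i => (s i : ℝ) / t))
        NoiseReinforced.yuleMeasure) ∧
    -- the exponent on the right-hand side does not depend on `t`
    (∀ (k : ℕ) (l : Fin k → ℝ) (s : Fin k → ℝ≥0) (t T : ℝ≥0), 0 < t → 0 < T →
      (∀ i, s i ≤ t) → (∀ i, s i ≤ T) →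
      (1 - p : ℂ) * (t : ℝ) *
          ∫ ω, NoiseReinforced.exponentAt a q Λ p l (fun i => (s i : ℝ) / t) ω
            ∂NoiseReinforced.yuleMeasure =
        (1 - p : ℂ) * (T : ℝ) *
          ∫ ω, NoiseReinforced.exponentAt a q Λ p l (fun i => (s i : ℝ) / T) ω
            ∂NoiseReinforced.yuleMeasure) ∧
    -- there is a noise reinforced Lévy process on `[0, ∞)`; its restriction to `[0, 1]` is a noise
    -- reinforced Lévy process on `[0, 1]`, and every such process has the law of the restriction
    ∃ (Ω : Type) (_ : MeasurableSpace Ω) (P : Measure Ω) (_ : IsProbabilityMeasure P)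
      (ξ : ℝ≥0 → Ω → ℝ),
      NoiseReinforced.IsNRLP a q Λ p P ξ ∧
      NoiseReinforced.IsNRLPUnit a q Λ p P (fun s => ξ (unitInterval.toNNReal s)) ∧
      ∀ (Ω' : Type*) [MeasurableSpace Ω'] (P' : Measure Ω') [IsProbabilityMeasure P']
        (X : unitInterval → Ω' → ℝ), NoiseReinforced.IsNRLPUnit a q Λ p P' X →
        IdentDistrib (fun ω (s : unitInterval) => ξ (unitInterval.toNNReal s) ω)
          (fun ω (s : unitInterval) => X s ω) P P' := by
  open NoiseReinforced in
  have hcont := hΛ.continuous_levyExponent a q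
  have h0 := levyExponent_zero a q Λ
  obtain ⟨γ, C, hγ, hpγ, hC0, hC⟩ := hp.exists_exponent a hΛ
  have hscale : ∀ (k : ℕ) (l : Fin k → ℝ) (s : Fin k → ℝ≥0) (t : ℝ≥0), 0 < t → (∀ i, s i ≤ t) →
      (1 - p : ℂ) * (t : ℝ) * ∫ ω, exponentAt a q Λ p l (fun i => (s i : ℝ) / t) ω ∂yuleMeasure =
        (1 - p) * ∫ ω, levyExponent a q Λ (yuleSum p l s ω) ∂birthMeasure :=
    fun k l s t ht hs => by
      rw [mul_assoc]
      congr 1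
      exact mul_integral_yuleSimon_div hcont.measurable h0 p l s ht hs
  refine ⟨fun k l s t ht _ => integrable_yuleSimon_div hcont.measurable ht
      (integrableOn_comp_yuleSum hcont.measurable hp.pos hγ hpγ hC l s t),
    fun k l s t T ht hT hst hsT => by rw [hscale k l s t ht hst, hscale k l s T hT hsT], ?_⟩
  obtain ⟨μ, hμ, hchar⟩ := exists_process (hΛ.isDivExponent a q) hcont h0 hp.pos hp.lt_one hγ hpγ
    hC0 hC
  have hξ : IsNRLP a q Λ p μ fun s x => x s :=
    ⟨fun s => measurable_pi_apply s, fun k l s t ht hs => by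
      rw [hscale k l s t ht hs]
      exact hchar k l s⟩
  have hξ' : IsNRLPUnit a q Λ p μ fun s x => x (unitInterval.toNNReal s) :=
    ⟨fun s => measurable_pi_apply _, fun k l s => by
      -- The defining formula on `[0, 1]` is the case `t = 1`.
      have h := hξ.charFun_eq k l (fun i => unitInterval.toNNReal (s i)) 1 one_pos
        fun i => (s i).2.2
      simpa using h⟩
  refine ⟨ℝ≥0 → ℝ, inferInstance, μ, hμ, fun s x => x s, hξ, hξ', fun Ω' _ P' _ X hX => ?_⟩
  exact identDistrib_of_integral_exp_eq hξ'.measurable hX.measurable fun k l s =>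
    (hξ'.charFun_eq k l s).trans (hX.charFun_eq k l s).symm
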